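/- **Conventions.** A point-line geometry $\Gamma$ is assumed to be connected, with any two distinct lines meeting in at most one point, and with collinearity graph of finite diameter $\mathrm{diam}(\Gamma)$; $d$ is the distance in that graph. A (full) projective embedding $\varepsilon:\Gamma\to\mathrm{PG}(W)$ is an injective map from the points of $\Gamma$ to the points of $\mathrm{PG}(W)$ whose image $|\varepsilon|$ spans $\mathrm{PG}(W)$ and which maps every line of $\Gamma$ onto a line of $\mathrm{PG}(W)$. It is *transparent* if every line of $\mathrm{PG}(W)$ contained in $|\varepsilon|$ is the image of a line of $\Gamma$. It is *$(a,b)$-opaque* if $$a+1=\max\{1\le h\le \mathrm{diam}(\Gamma) : \langle\varepsilon(x),\varepsilon(y)\rangle\subseteq|\varepsilon| \text{ for all } x,y \text{ with } d(x,y)\le h\},$$ $$b+1=\min\{1\le h\le \mathrm{diam}(\Gamma) : \langle\varepsilon(x),\varepsilon(y)\rangle\not\subseteq|\varepsilon| \text{ for all } x,y \text{ with } d(x,y)>h\}.$$ It is *completely opaque* if $\mathrm{diam}(\Gamma)>1$ and $|\varepsilon|$ is the whole point-set of $\mathrm{PG}(W)$. Let $V$ be a vector space of finite dimension $N$ over a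 (commutative) field $\mathbb K$. For $1\le k<N$ the points of the projective $k$-grassmannian $\mathcal G_k$ of $\mathrm{PG}(V)$ are the $k$-dimensional subspaces of $V$, and its lines are the sets $\{Z: X\subset Z\subset Y,\ \dim Z=k\}$ with $X\subset Y$, $\dim X=k-1$, $\dim Y=k+1$. Its Plücker embedding in $\mathrm{PG}(\bigwedge^kV)$ maps $\langle v_1,\dots,v_k\rangle$ to $\langle v_1\wedge\dots\wedge v_k\rangle$. Let $\mathcal S$ be a polar space of rank $n\ge 2$ associated to a form on $V$ which is either non-degenerate alternating (symplectic type), or non-singular quadratic, or non-degenerate hermitian with respect to an involutory automorphism $\sigma\ne\mathrm{id}$ of $\mathbb K$. Its singular subspaces are the subspaces of $V$ that are totally isotropic (totally singular in the quadratic case), and $n$ is their maximal dimension. For $1\le k\le n$ the points of the polar $k$-grassmannian $\mathcal S_k$ are the $k$-dimensional singular subspaces. For $k<n$ its lines are the sets $\{Z: X\subset Z\subset Y,\ \dim Z=k\}$ with $X\subset Y$ singular, $\dim X=k-1$, $\dim Y=k+1$; for $k=n$ they are the sets of all $n$-dimensional singular subspaces containing a given singular subspace of dimension $n-1$. If $k<n$,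 or if $k=n$ and $\mathcal S$ is of symplectic type, the Plücker embedding of $\mathcal S_k$ is the restriction of that of $\mathcal G_k$, with codomain the projective span of its image in $\mathrm{PG}(\bigwedge^kV)$. If $\mathcal S$ is hermitian, $N=2n$ and $k=n$, let $\mathbb K_\sigma$ be the subfield of $\mathbb K$ fixed by $\sigma$, and let $W$ be the $\mathbb K_\sigma$-span of a $\mathbb K$-basis of $\bigwedge^nV$ whose members represent Plücker points of points of $\mathcal S_n$, chosen so that the Plücker points of all points of $\mathcal S_n$ belong to the Baer subgeometry $\mathrm{PG}(W)$; the Plücker embedding of $\mathcal S_n$ is the resulting map $\mathcal S_n\to\mathrm{PG}(W)$. **Theorem 1.** The maps called Plücker embeddings above are projective embeddings, and the following hold. 1. The Plücker embedding of $\mathcal G_k$ is transparent for every $1\le k<N$. 2. If $1\le k<n$ and $\mathcal S$ is not of symplectic type (that is, it arises from a quadratic or hermitian form), then the Plücker embedding of $\mathcal S_k$ is transparent. 3. Let $\mathcal S$ be of symplectic type. Then the Plücker embedding of $\mathcal S_1$ is completely opaque; for $1<k<n$ the Plücker embedding of $\mathcal S_k$ is $(0,1)$-opaque; and the Plücker embedding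 of $\mathcal S_n$ is transparent. 4. If $\mathcal S$ arises from a hermitian form and $N=2n$, then a subspace $W$ as above exists and, for every such $W$, the Plücker embedding $\mathcal S_n\to\mathrm{PG}(W)$ is transparent. -/

import Mathlib

open Module
open scoped LinearAlgebra.Projectivization

/-! ### Point-line geometries -/

/-- A system of points and lines: `P` is the set of points, and a line is the set of its points. -/
structure PointLineGeometry (P : Type*) where
  /-- The set of lines. -/
  lines : Set (Set P)

namespace PointLineGeometry

variable {P : Type*}

/-- Two points are collinear when they are distinct and some line contains both. -/
def collinearityGraph (Γ : PointLineGeometry P) : SimpleGraph P where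
  Adj x y := x ≠ y ∧ ∃ l ∈ Γ.lines, x ∈ l ∧ y ∈ l
  symm := ⟨fun _ _ h => ⟨h.1.symm, h.2.imp fun _ hl => ⟨hl.1, hl.2.2, hl.2.1⟩⟩⟩
  loopless := ⟨fun _ h => h.1 rfl⟩

/-- The standing conventions on point-line geometries: the geometry is connected, two distinct
lines have at most one common point, and the collinearity graph has finite diameter. -/
structure IsAdmissible (Γ : PointLineGeometry P) : Prop where
  connected : Γ.collinearityGraph.Connected
  partialLinear : ∀ l ∈ Γ.lines, ∀ m ∈ Γ.lines, l ≠ m → (l ∩ m).Subsingleton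
  finiteDiam : Γ.collinearityGraph.ediam ≠ ⊤

end PointLineGeometry

/-! ### Full projective embeddings, transparency and opacity -/

section Embeddings

variable {F W : Type*} [Field F] [AddCommGroup W] [Module F W] {P : Type*}

/-- A set of points of `PG(W)` is a line: it consists of the points contained in some
two-dimensional subspace of `W`. -/
def IsProjLine (L : Set (ℙ F W)) : Prop :=
  ∃ U : Submodule F W, finrank F U = 2 ∧ L = {p | p.submodule ≤ U}

/-- The subspace of `PG(W)` spanned by two points, as a set of points. It is the line through
the two points if these are distinct. -/
def joinPoints (p q : ℙ F W) : Set (ℙ F W) :=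
  {r | r.submodule ≤ p.submodule ⊔ q.submodule}

/-- `ε` is a (full) projective embedding of the point-line geometry `Γ` in `PG(W)`. -/
structure IsProjectiveEmbedding (Γ : PointLineGeometry P) (ε : P → ℙ F W) : Prop where
  admissible : Γ.IsAdmissible
  injective : Function.Injective ε
  span_eq_top : ⨆ x, (ε x).submodule = ⊤
  map_line : ∀ l ∈ Γ.lines, IsProjLine (ε '' l)

/-- A projective embedding is transparent when every line of the projective space which is
contained in the image of the point-set is the image of a line of the geometry. -/
def IsTransparent (Γ : PointLineGeometry P) (ε : P → ℙ F W) : Prop :=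
  IsProjectiveEmbedding Γ ε ∧
    ∀ L : Set (ℙ F W), IsProjLine L → L ⊆ Set.range ε → ∃ l ∈ Γ.lines, ε '' l = L

/-- A projective embedding is `(a, b)`-opaque when `a` and `b` are its lower and upper degrees of
opacity: `a + 1` is the largest `h` with `1 ≤ h ≤ diam` such that the span of the images of any
two points at distance at most `h` is contained in the image of the point-set, and `b + 1` is the
smallest `h` with `1 ≤ h ≤ diam` such that, for any two points at distance greater than `h`, the
span of their images is not contained in the image of the point-set. -/
def IsOpaque (Γ : PointLineGeometry P) (ε : P → ℙ F W) (a b : ℕ) : Prop :=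
  IsProjectiveEmbedding Γ ε ∧
    IsGreatest {h : ℕ | 1 ≤ h ∧ h ≤ Γ.collinearityGraph.diam ∧
      ∀ x y, Γ.collinearityGraph.dist x y ≤ h → joinPoints (ε x) (ε y) ⊆ Set.range ε} (a + 1) ∧
    IsLeast {h : ℕ | 1 ≤ h ∧ h ≤ Γ.collinearityGraph.diam ∧
      ∀ x y, h < Γ.collinearityGraph.dist x y → ¬ joinPoints (ε x) (ε y) ⊆ Set.range ε} (b + 1)

/-- A projective embedding is completely opaque when the geometry has diameter greater than one
and every point of the projective space is the image of a point of the geometry. -/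
def IsCompletelyOpaque (Γ : PointLineGeometry P) (ε : P → ℙ F W) : Prop :=
  IsProjectiveEmbedding Γ ε ∧ 1 < Γ.collinearityGraph.diam ∧ Set.range ε = Set.univ

/-- The subspace of `W` underlying the projective span of the image of `ε`. -/
def imageSpan (ε : P → ℙ F W) : Submodule F W := ⨆ x, (ε x).submodule

theorem rep_mem_imageSpan (ε : P → ℙ F W) (x : P) : (ε x).rep ∈ imageSpan ε := by
  have h : (ε x).submodule ≤ imageSpan ε := le_iSup (fun x => (ε x).submodule) x
  rw [Projectivization.submodule_eq] at h
  exact h (Submodule.mem_span_singleton_self _)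

/-- The map `ε`, with codomain restricted to the projective span of its image. -/
noncomputable def toImageSpan (ε : P → ℙ F W) (x : P) : ℙ F (imageSpan ε) :=
  Projectivization.mk F ⟨(ε x).rep, rep_mem_imageSpan ε x⟩
    (fun h => (ε x).rep_nonzero (congrArg Subtype.val h))

end Embeddings

/-! ### Plücker points -/

section Plucker

variable {K V : Type*} [Field K] [AddCommGroup V] [Module K V]

theorem iotaMulti_ne_zero {k : ℕ} {v : Fin k → V} (hv : LinearIndependent K v) :
    exteriorPower.ιMulti K k v ≠ 0 := by
  intro h0
  obtain ⟨g, hg⟩ : ∃ g : V →ₗ[K] (Fin k → K), ∀ i, g (v i) = Pi.basisFun K (Fin k) i := by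
    obtain ⟨g, hg⟩ := LinearMap.exists_extend ((Basis.span hv).constr K (Pi.basisFun K (Fin k)))
    refine ⟨g, fun i => ?_⟩
    have h := congrArg (fun φ => φ (Basis.span hv i)) hg
    simp only [LinearMap.comp_apply, Basis.constr_basis] at h
    rwa [Submodule.subtype_apply, Basis.span_apply] at h
  have h1 := exteriorPower.alternatingMapLinearEquiv_apply_ιMulti
    ((Pi.basisFun K (Fin k)).det.compLinearMap g) v
  rw [h0, map_zero, AlternatingMap.compLinearMap_apply] at h1
  have h2 : (fun i => g (v i)) = Pi.basisFun K (Fin k) := funext hg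
  rw [h2, Basis.det_self] at h1
  exact zero_ne_one h1

/-- The point `⟨v₁ ∧ ⋯ ∧ v_k⟩` of `PG(⋀ᵏ V)`, where `v₁, …, v_k` is a basis of `A`. -/
noncomputable def pluckerPoint [FiniteDimensional K V] {k : ℕ} (A : Submodule K V)
    (hA : finrank K A = k) : ℙ K (⋀[K]^k V) :=
  Projectivization.mk K
    (exteriorPower.ιMulti K k fun i => (finBasisOfFinrankEq K A hA i : V))
    (iotaMulti_ne_zero
      ((finBasisOfFinrankEq K A hA).linearIndependent.map' A.subtype A.ker_subtype))

/-- The Plücker point does not depend on the chosen basis. -/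
theorem pluckerPoint_eq [FiniteDimensional K V] {k : ℕ} (A : Submodule K V)
    (hA : finrank K A = k) (v : Fin k → V) (hv : LinearIndependent K v) (hmem : ∀ i, v i ∈ A) :
    pluckerPoint A hA =
      Projectivization.mk K (exteriorPower.ιMulti K k v) (iotaMulti_ne_zero hv) := by
  set b := finBasisOfFinrankEq K A hA
  have key : (exteriorPower.ιMulti K k).compLinearMap A.subtype =
      (LinearMap.toSpanSingleton K (⋀[K]^k V)
        (exteriorPower.ιMulti K k fun i => (b i : V))).compAlternatingMap b.det := by
    refine Basis.ext_alternating b fun w hw => ?_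
    let e : Equiv.Perm (Fin k) := Equiv.ofBijective w (Finite.injective_iff_bijective.1 hw)
    have h1 : (fun i => b (w i)) = b ∘ e := rfl
    rw [h1, AlternatingMap.map_perm, AlternatingMap.map_perm]
    congr 1
    simp [Basis.det_self]
  have h2 := congrArg (fun φ => φ fun i => (⟨v i, hmem i⟩ : A)) key
  simp only [AlternatingMap.compLinearMap_apply, LinearMap.compAlternatingMap_apply,
    LinearMap.toSpanSingleton_apply, Submodule.subtype_apply] at h2
  symm
  rw [pluckerPoint, Projectivization.mk_eq_mk_iff']
  exact ⟨_, h2.symm⟩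

end Plucker

/-! ### Projective grassmannians -/

section ProjectiveGrassmannian

variable (K V : Type*) [Field K] [AddCommGroup V] [Module K V]

/-- The points of the `k`-grassmannian of `PG(V)`: the `k`-dimensional subspaces of `V`. -/
abbrev GrassPoint (k : ℕ) : Type _ := {Z : Submodule K V // finrank K Z = k}

/-- The `k`-grassmannian of `PG(V)`; its lines are the sets of all `k`-dimensional `Z` with
`X ≤ Z ≤ Y`, where `X ≤ Y` have dimension `k - 1` and `k + 1`. -/
def projGrassmannian (k : ℕ) : PointLineGeometry (GrassPoint K V k) where
  lines := {l | ∃ X Y : Submodule K V, X ≤ Y ∧ finrank K X + 1 = k ∧ finrank K Y = k + 1 ∧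
    l = {Z | X ≤ Z.1 ∧ Z.1 ≤ Y}}

/-- The Plücker embedding of the `k`-grassmannian of `PG(V)` in `PG(⋀ᵏ V)`. -/
noncomputable def projPlucker [FiniteDimensional K V] (k : ℕ) :
    GrassPoint K V k → ℙ K (⋀[K]^k V) :=
  fun Z => pluckerPoint Z.1 Z.2

end ProjectiveGrassmannian

/-! ### Classical polar spaces over a field and their grassmannians -/

section Polar

variable {K V : Type*} [Field K] [AddCommGroup V] [Module K V]

/-- The totally isotropic subspaces for a (sesqui)linear form: bilinear if `σ` is the identity. -/
def isotropicSubspaces {σ : K →+* K} (f : V →ₛₗ[σ] V →ₗ[K] K) : Set (Submodule K V) :=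
  {X | ∀ x ∈ X, ∀ y ∈ X, f x y = 0}

/-- The totally singular subspaces for a quadratic form. -/
def singularSubspaces (q : QuadraticForm K V) : Set (Submodule K V) :=
  {X | ∀ x ∈ X, q x = 0}

/-- `f` is a non-degenerate alternating bilinear form. -/
def IsSymplecticForm (f : V →ₗ[K] V →ₗ[K] K) : Prop :=
  f.IsAlt ∧ f.Nondegenerate

/-- `f` is a non-degenerate `σ`-hermitian form, for an involutory automorphism `σ ≠ id`. -/
def IsHermitianForm (σ : K →+* K) (f : V →ₛₗ[σ] V →ₗ[K] K) : Prop :=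
  (∀ a, σ (σ a) = a) ∧ σ ≠ RingHom.id K ∧ (∀ x y, σ (f x y) = f y x) ∧ f.Nondegenerate

/-- `q` is non-singular: no non-zero singular vector is orthogonal to all of `V` with respect to
the bilinearization of `q`. -/
def IsNonsingularQuadratic (q : QuadraticForm K V) : Prop :=
  ∀ v, q v = 0 → (∀ w, QuadraticMap.polar q v w = 0) → v = 0

/-- The maximal dimension of a member of `S` is `n`: for the set `S` of singular subspaces of a
polar space, this says that the polar space has rank `n`. -/
def HasPolarRank (S : Set (Submodule K V)) (n : ℕ) : Prop :=
  (∃ X ∈ S, finrank K X = n) ∧ ∀ X ∈ S, finrank K X ≤ n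

/-- The points of the polar `k`-grassmannian: the singular subspaces of dimension `k`. -/
abbrev PolarPoint (S : Set (Submodule K V)) (k : ℕ) : Type _ :=
  {Z : Submodule K V // Z ∈ S ∧ finrank K Z = k}

/-- The `k`-grassmannian of the polar space of rank `n` with set `S` of singular subspaces.
If `k < n`, a line consists of all `k`-dimensional `Z` with `X ≤ Z ≤ Y`, where `X ≤ Y` are singular
of dimension `k - 1` and `k + 1`. If `k = n`, a line consists of all `n`-dimensional singular
subspaces containing a given singular subspace of dimension `n - 1`. -/
def polarGrassmannian (S : Set (Submodule K V)) (n k : ℕ) :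
    PointLineGeometry (PolarPoint S k) where
  lines := {l |
    (k < n ∧ ∃ X ∈ S, ∃ Y ∈ S, X ≤ Y ∧ finrank K X + 1 = k ∧ finrank K Y = k + 1 ∧
      l = {Z | X ≤ Z.1 ∧ Z.1 ≤ Y}) ∨
    (k = n ∧ ∃ X ∈ S, finrank K X + 1 = k ∧ l = {Z | X ≤ Z.1})}

variable [FiniteDimensional K V]

/-- The Plücker map of the polar `k`-grassmannian, as a map to `PG(⋀ᵏ V)`. -/
noncomputable def polarPluckerMap (S : Set (Submodule K V)) (k : ℕ) :
    PolarPoint S k → ℙ K (⋀[K]^k V) :=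
  fun Z => pluckerPoint Z.1 Z.2.2

/-- The Plücker map of the polar `k`-grassmannian, as a map to the projective span of its image
in `PG(⋀ᵏ V)`. -/
noncomputable def polarPlucker (S : Set (Submodule K V)) (k : ℕ) :
    PolarPoint S k → ℙ K (imageSpan (polarPluckerMap S k)) :=
  toImageSpan (polarPluckerMap S k)

/-! ### The Plücker embedding of hermitian dual polar spaces in dimension `2n` -/

/-- The subfield of `K` fixed by `σ`. -/
abbrev fixedSubfield (σ : K →+* K) : Subfield K := σ.eqLocusField (RingHom.id K)

/-- `W` is the span over the subfield fixed by `σ` of a `K`-basis of `⋀ⁿ V` whose members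
represent Plücker points of members of `S`, and every Plücker point of an `n`-dimensional member
of `S` is represented by a vector of `W`, that is, belongs to the Baer subgeometry `PG(W)`. -/
structure IsBaerCodomain (σ : K →+* K) (S : Set (Submodule K V)) (n : ℕ)
    (W : Submodule (fixedSubfield σ) (⋀[K]^n V)) : Prop where
  exists_basis : ∃ U : Basis (Fin (finrank K (⋀[K]^n V))) K (⋀[K]^n V),
    (∀ i, ∃ A : PolarPoint S n, (polarPluckerMap S n A).submodule = K ∙ U i) ∧
      W = Submodule.span (fixedSubfield σ) (Set.range U)
  exists_rep : ∀ A : PolarPoint S n, ∃ w : W,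
    w ≠ 0 ∧ (polarPluckerMap S n A).submodule = K ∙ (w : ⋀[K]^n V)

/-- The Plücker map of a dual polar space, as a map to the Baer subgeometry `PG(W)`. -/
noncomputable def baerPlucker {σ : K →+* K} {S : Set (Submodule K V)} {n : ℕ}
    {W : Submodule (fixedSubfield σ) (⋀[K]^n V)} (hW : IsBaerCodomain σ S n W) :
    PolarPoint S n → ℙ (fixedSubfield σ) W :=
  fun A => Projectivization.mk (fixedSubfield σ) (hW.exists_rep A).choose
    (hW.exists_rep A).choose_spec.1

end Polar

/-! Everything rests on two facts about decomposable vectors. If the sum of the Plücker vectors of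
distinct `A` and `B` is again decomposable, then `A ⊓ B` is a hyperplane of both
(`finrank_inf_of_add`). Conversely, if `A ⊓ B` is such a hyperplane, the line joining the two
Plücker points consists exactly of the Plücker points of the pencil `A ⊓ B ≤ C ≤ A ⊔ B`
(`joinPoints_pluckerPoint`). So a join lies in the image of a grassmannian if and only if its ends
coincide or span a pencil all of whose members are points of the geometry. For projective
grassmannians this is collinearity. For `k < n`, collinearity in the polar grassmannian also needs
`A ⊔ B` singular. In the quadratic and hermitian cases the pencil covers `A ⊔ B`, and a subspace all
of whose vectors are singular is singular, which gives transparency. In the symplectic case every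
vector is isotropic, so the pencil is singular as soon as `A` and `B` are: some pairs at distance
two are then joined inside the image, others are not, and pairs farther apart never are. For `k =
n`, collinearity is just meeting in a hyperplane, so transparency returns. For hermitian dual polar
spaces the main work is the Baer subgeometry. Pairing with `y₁ ∧ ⋯ ∧ y_n` by a volume form, and by
the extension of `f` followed by `σ`, gives two functions on `⋀ⁿ V`, one linear and one semilinear.
On a Plücker vector of a maximal isotropic subspace they are proportional for all `y` at once, and
representatives can be scaled so that one factor `μ` serves every maximal subspace
(`isBaerVector_cons`, with connectedness). Vectors with factor `μ` form a space over the fixed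
field. The maximal subspaces span `⋀ⁿ V` by an exchange argument on hyperbolic bases
(`apply_hyperbolicSystem_eq_zero`), and nondegeneracy then makes the coordinates of all
representatives fixed by `σ`. -/

/-! ### Lines of projective spaces and restriction of the codomain to the span of the image -/

section ProjectiveLines

variable {F W : Type*} [Field F] [AddCommGroup W] [Module F W] {P : Type*}

theorem mk_mem_joinPoints_mk {u v w : W} (hu : u ≠ 0) (hv : v ≠ 0) (hw : w ≠ 0) :
    Projectivization.mk F u hu ∈ joinPoints (Projectivization.mk F v hv)
      (Projectivization.mk F w hw) ↔ ∃ a b : F, a • v + b • w = u := by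
  simp only [joinPoints, Set.mem_ofPred_eq, Projectivization.submodule_mk]
  rw [Submodule.span_singleton_le_iff_mem, ← Submodule.span_insert, Submodule.mem_span_pair]

theorem joinPoints_self (p : ℙ F W) : joinPoints p p = {p} := by
  ext r
  simp only [joinPoints, Set.mem_ofPred_eq, Set.mem_singleton_iff, sup_idem]
  constructor
  · intro h
    exact Projectivization.submodule_injective
      (Submodule.eq_of_le_of_finrank_eq h (by simp [Projectivization.finrank_submodule]))
  · rintro rfl; exact le_rfl

theorem finrank_submodule_sup {p q : ℙ F W} (h : p ≠ q) :
    finrank F (p.submodule ⊔ q.submodule : Submodule F W) = 2 := by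
  have h1 := Projectivization.linearIndependent_pair_iff_ne.2 h
  rw [Projectivization.submodule_eq, Projectivization.submodule_eq, ← Submodule.span_insert,
    ← Matrix.range_cons_cons_empty _ _ ![]]
  rw [finrank_span_eq_card h1]; rfl

theorem isProjLine_joinPoints {p q : ℙ F W} (h : p ≠ q) : IsProjLine (joinPoints p q) :=
  ⟨_, finrank_submodule_sup h, rfl⟩

theorem IsProjLine.eq_joinPoints {L : Set (ℙ F W)} (hL : IsProjLine L) {p q : ℙ F W} (hp : p ∈ L)
    (hq : q ∈ L) (h : p ≠ q) : L = joinPoints p q := by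
  obtain ⟨U, hU, rfl⟩ := hL
  have : FiniteDimensional F U := FiniteDimensional.of_finrank_pos (by omega)
  have : p.submodule ⊔ q.submodule = U :=
    Submodule.eq_of_le_of_finrank_eq (sup_le hp hq) (by rw [hU, finrank_submodule_sup h])
  rw [joinPoints, this]

theorem IsProjLine.exists_ne {L : Set (ℙ F W)} (hL : IsProjLine L) :
    ∃ p ∈ L, ∃ q ∈ L, p ≠ q := by
  obtain ⟨U, hU, rfl⟩ := hL
  have : FiniteDimensional F U := FiniteDimensional.of_finrank_pos (by omega)
  let b := finBasisOfFinrankEq F U hU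
  have hn : ∀ i, (b i : W) ≠ 0 := fun i h => b.ne_zero i (Subtype.ext h)
  refine ⟨.mk F _ (hn 0), ?_, .mk F _ (hn 1), ?_, ?_⟩
  · simp [Projectivization.submodule_mk]
  · simp [Projectivization.submodule_mk]
  · intro h
    rw [Projectivization.mk_eq_mk_iff'] at h
    obtain ⟨a, ha⟩ := h
    have h2 : a • b 1 = b 0 := Subtype.ext ha
    have := congrArg (fun v => b.repr v 0) h2
    simp at this

theorem IsProjectiveEmbedding.of_joinPoints {Γ : PointLineGeometry P} {ε : P → ℙ F W}
    (hadm : Γ.IsAdmissible) (hinj : Function.Injective ε) (hspan : ⨆ x, (ε x).submodule = ⊤)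
    (hmap : ∀ l ∈ Γ.lines, ∃ x y, x ≠ y ∧ ε '' l = joinPoints (ε x) (ε y)) :
    IsProjectiveEmbedding Γ ε :=
  ⟨hadm, hinj, hspan, fun l hl => by
    obtain ⟨x, y, hxy, h⟩ := hmap l hl
    rw [h]
    exact isProjLine_joinPoints (hinj.ne hxy)⟩

/-- A criterion for transparency in terms of pairs of points. -/
theorem IsProjectiveEmbedding.isTransparent {Γ : PointLineGeometry P} {ε : P → ℙ F W}
    (hemb : IsProjectiveEmbedding Γ ε)
    (hline : ∀ x y, x ≠ y → joinPoints (ε x) (ε y) ⊆ Set.range ε →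
      ∃ l ∈ Γ.lines, x ∈ l ∧ y ∈ l) : IsTransparent Γ ε := by
  refine ⟨hemb, fun L hL hLr => ?_⟩
  obtain ⟨p, hp, q, hq, hpq⟩ := hL.exists_ne
  obtain ⟨x, rfl⟩ := hLr hp
  obtain ⟨y, rfl⟩ := hLr hq
  have hLe := hL.eq_joinPoints hp hq hpq
  obtain ⟨l, hl, hx, hy⟩ := hline x y (fun h => hpq (h ▸ rfl)) (hLe ▸ hLr)
  exact ⟨l, hl, by
    rw [hLe, (hemb.map_line l hl).eq_joinPoints ⟨x, hx, rfl⟩ ⟨y, hy, rfl⟩ hpq]⟩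

section ImageSpan

variable (ε : P → ℙ F W)

/-- The inclusion of the projective span of the image of `ε`. -/
def imageSpanInclusion : ℙ F (imageSpan ε) → ℙ F W :=
  Projectivization.map (imageSpan ε).subtype (imageSpan ε).injective_subtype

theorem imageSpanInclusion_injective : Function.Injective (imageSpanInclusion ε) :=
  Projectivization.map_injective (τ := RingHom.id F) _ _

theorem imageSpanInclusion_toImageSpan (x : P) :
    imageSpanInclusion ε (toImageSpan ε x) = ε x := by
  rw [imageSpanInclusion, toImageSpan, Projectivization.map_mk]
  exact Projectivization.mk_rep _

theorem imageSpanInclusion_comp_toImageSpan : imageSpanInclusion ε ∘ toImageSpan ε = ε :=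
  funext (imageSpanInclusion_toImageSpan ε)

theorem submodule_imageSpanInclusion (p : ℙ F (imageSpan ε)) :
    (imageSpanInclusion ε p).submodule = p.submodule.map (imageSpan ε).subtype := by
  induction p using Projectivization.ind with
  | h v hv =>
    rw [imageSpanInclusion, Projectivization.map_mk, Projectivization.submodule_mk,
      Projectivization.submodule_mk, Submodule.map_span, Set.image_singleton]

theorem image_joinPoints_imageSpan (p q : ℙ F (imageSpan ε)) :
    imageSpanInclusion ε '' joinPoints p q =
      joinPoints (imageSpanInclusion ε p) (imageSpanInclusion ε q) := by
  have hmem : ∀ r, imageSpanInclusion ε r ∈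
      joinPoints (imageSpanInclusion ε p) (imageSpanInclusion ε q) ↔ r ∈ joinPoints p q := by
    intro r
    simp only [joinPoints, Set.mem_ofPred_eq, submodule_imageSpanInclusion, ← Submodule.map_sup]
    exact Submodule.map_le_map_iff_of_injective (imageSpan ε).injective_subtype _ _
  ext r
  constructor
  · rintro ⟨r, hr, rfl⟩
    exact (hmem r).2 hr
  · intro hr
    induction r using Projectivization.ind with
    | h v hv =>
      have hle : v ∈ imageSpan ε := by
        have h1 : (Projectivization.mk F v hv).submodule ≤ _ := hr
        rw [submodule_imageSpanInclusion, submodule_imageSpanInclusion, ← Submodule.map_sup,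
          Projectivization.submodule_mk, Submodule.span_singleton_le_iff_mem] at h1
        exact Submodule.map_subtype_le _ _ h1
      have heq : imageSpanInclusion ε (.mk F ⟨v, hle⟩ fun h => hv (congrArg Subtype.val h)) =
          .mk F v hv := by
        rw [imageSpanInclusion, Projectivization.map_mk]; rfl
      exact ⟨_, (hmem _).1 (heq ▸ hr), heq⟩

theorem image_joinPoints_toImageSpan (x y : P) :
    imageSpanInclusion ε '' joinPoints (toImageSpan ε x) (toImageSpan ε y) =
      joinPoints (ε x) (ε y) := by
  rw [image_joinPoints_imageSpan, imageSpanInclusion_toImageSpan, imageSpanInclusion_toImageSpan]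

/-- The inclusion of the span is injective and carries joins to joins, so questions of opacity can
be settled in the full exterior power. -/
theorem joinPoints_toImageSpan_subset_range (x y : P) :
    joinPoints (toImageSpan ε x) (toImageSpan ε y) ⊆ Set.range (toImageSpan ε) ↔
      joinPoints (ε x) (ε y) ⊆ Set.range ε := by
  rw [← Set.image_subset_image_iff (imageSpanInclusion_injective ε),
    image_joinPoints_toImageSpan, ← Set.range_comp, imageSpanInclusion_comp_toImageSpan]

theorem image_toImageSpan_eq_joinPoints (l : Set P) (x y : P) :
    toImageSpan ε '' l = joinPoints (toImageSpan ε x) (toImageSpan ε y) ↔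
      ε '' l = joinPoints (ε x) (ε y) := by
  rw [← (imageSpanInclusion_injective ε).image_injective.eq_iff, image_joinPoints_toImageSpan,
    ← Set.image_comp, imageSpanInclusion_comp_toImageSpan]

theorem toImageSpan_injective (h : Function.Injective ε) : Function.Injective (toImageSpan ε) := by
  apply Function.Injective.of_comp (f := imageSpanInclusion ε)
  rwa [imageSpanInclusion_comp_toImageSpan]

theorem iSup_toImageSpan : ⨆ x, (toImageSpan ε x).submodule = ⊤ := by
  apply Submodule.map_injective_of_injective (imageSpan ε).injective_subtype
  simp only [Submodule.map_iSup, ← submodule_imageSpanInclusion, imageSpanInclusion_toImageSpan,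
    Submodule.map_top, Submodule.range_subtype]
  rfl

end ImageSpan

end ProjectiveLines

/-! ### Bounds on distances in collinearity graphs -/

section CollinearityDistance

variable {P : Type*}

/-- If from every point `x ≠ y` one can move at bounded cost to a point with a smaller
defect with respect to `y`, then distances are bounded in terms of the defect. -/
theorem edist_le_of_forall_exists_lt (G : SimpleGraph P) (c : ℕ) (y : P) (μ : P → ℕ)
    (h : ∀ x, x ≠ y → ∃ z, G.edist x z ≤ c ∧ μ z < μ x) (x : P) :
    G.edist x y ≤ ((c * μ x : ℕ) : ℕ∞) := by
  induction hm : μ x using Nat.strong_induction_on generalizing x with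
  | _ m ih =>
    by_cases hxy : x = y
    · simp [hxy]
    obtain ⟨z, hz, hlt⟩ := h x hxy
    have h2 := ih _ (hm ▸ hlt) z rfl
    calc G.edist x y ≤ G.edist x z + G.edist z y := G.edist_triangle
      _ ≤ c + ((c * μ z : ℕ) : ℕ∞) := add_le_add hz h2
      _ = ((c * (μ z + 1) : ℕ) : ℕ∞) := by push_cast; ring
      _ ≤ ((c * m : ℕ) : ℕ∞) := by
        exact_mod_cast Nat.mul_le_mul_left c (by omega : μ z + 1 ≤ m)

/-- Unreachable points have extended distance `⊤`, so one finite bound gives connectedness and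
finite diameter together. -/
theorem PointLineGeometry.IsAdmissible.of_edist_le {Γ : PointLineGeometry P} [Nonempty P] (N : ℕ)
    (hd : ∀ x y, Γ.collinearityGraph.edist x y ≤ N)
    (hl : ∀ l ∈ Γ.lines, ∀ m ∈ Γ.lines, ∀ x y, x ≠ y → x ∈ l → y ∈ l → x ∈ m → y ∈ m → l = m) :
    Γ.IsAdmissible := by
  have h1 : Γ.collinearityGraph.ediam ≠ ⊤ :=
    ne_top_of_le_ne_top (ENat.natCast_ne_top N) (SimpleGraph.ediam_le_of_edist_le hd)
  refine ⟨SimpleGraph.connected_of_ediam_ne_top h1, fun l hl' m hm hne x hx y hy => ?_, h1⟩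
  by_contra hxy
  exact hne (hl l hl' m hm x y hxy hx.1 hy.1 hx.2 hy.2)

end CollinearityDistance

/-! ### Dimensions and pencils of subspaces -/

section Subspaces

variable {K V : Type*} [Field K] [AddCommGroup V] [Module K V]

theorem ne_of_finrank_inf {A B : Submodule K V} {k : ℕ} (hA : finrank K A = k)
    (hX : finrank K (A ⊓ B : Submodule K V) + 1 = k) : A ≠ B := by
  rintro rfl
  rw [inf_idem] at hX
  omega

variable [FiniteDimensional K V]

theorem sup_span_singleton_eq {X A : Submodule K V} {a : V} (hXA : X ≤ A)
    (hd : finrank K X + 1 = finrank K A) (ha : a ∈ A) (haX : a ∉ X) : X ⊔ K ∙ a = A :=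
  Submodule.eq_of_le_of_finrank_eq
    (sup_le hXA ((Submodule.span_singleton_le_iff_mem _ _).2 ha))
    (by rw [Submodule.finrank_sup_span_singleton haX, hd])

theorem exists_between_finrank_eq {X Y : Submodule K V} (h : X ≤ Y) {j : ℕ}
    (hX : finrank K X ≤ j) (hY : j ≤ finrank K Y) :
    ∃ Z, X ≤ Z ∧ Z ≤ Y ∧ finrank K Z = j := by
  induction j, hX using Nat.le_induction with
  | base => exact ⟨X, le_rfl, h, rfl⟩
  | succ j hj ih =>
    obtain ⟨Z, hXZ, hZY, hZ⟩ := ih (by omega)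
    obtain ⟨y, hy, hyZ⟩ := SetLike.exists_of_lt
      (lt_of_le_of_ne hZY (fun h => by rw [h] at hZ; omega))
    exact ⟨Z ⊔ K ∙ y, hXZ.trans le_sup_left,
      sup_le hZY ((Submodule.span_singleton_le_iff_mem _ _).2 hy),
      by rw [Submodule.finrank_sup_span_singleton hyZ, hZ]⟩

theorem inf_eq_of_finrank {X A B : Submodule K V} {k : ℕ} (hA : finrank K A = k)
    (hB : finrank K B = k) (hXA : X ≤ A) (hXB : X ≤ B) (hX : finrank K X + 1 = k)
    (hne : A ≠ B) : A ⊓ B = X := by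
  have h1 : finrank K (A ⊓ B : Submodule K V) < finrank K A := by
    refine Submodule.finrank_lt_finrank_of_lt (lt_of_le_of_ne inf_le_left fun h => hne ?_)
    exact Submodule.eq_of_le_of_finrank_eq (inf_eq_left.1 h) (by rw [hA, hB])
  have h2 : X ≤ A ⊓ B := le_inf hXA hXB
  exact (Submodule.eq_of_le_of_finrank_le h2 (by omega)).symm

theorem finrank_sup_of_finrank_inf {A B : Submodule K V} {k : ℕ} (hA : finrank K A = k)
    (hB : finrank K B = k) (hX : finrank K (A ⊓ B : Submodule K V) + 1 = k) :
    finrank K (A ⊔ B : Submodule K V) = k + 1 := by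
  have := Submodule.finrank_sup_add_finrank_inf_eq A B
  omega

/-- Lets every grassmannian line be written as the pencil from the meet to the join of two of its
members, the form in which joins of Plücker points are computed. -/
theorem exists_pair_between {X Y : Submodule K V} (h : X ≤ Y) {k : ℕ}
    (hX : finrank K X + 1 = k) (hY : finrank K Y = k + 1) :
    ∃ A B : Submodule K V, finrank K A = k ∧ finrank K B = k ∧ A ≠ B ∧ A ⊓ B = X ∧ A ⊔ B = Y := by
  obtain ⟨A, hXA, hAY, hA⟩ := exists_between_finrank_eq h (j := k) (by omega) (by omega)
  obtain ⟨b, hb, hbA⟩ := SetLike.exists_of_lt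
      (lt_of_le_of_ne hAY (fun h => by rw [h] at hA; omega))
  have hB : finrank K (X ⊔ K ∙ b : Submodule K V) = k := by
    rw [Submodule.finrank_sup_span_singleton fun h => hbA (hXA h), hX]
  have hne : A ≠ X ⊔ K ∙ b := by
    rintro rfl
    exact hbA (Submodule.mem_sup_right (Submodule.mem_span_singleton_self b))
  have hinf := inf_eq_of_finrank hA hB hXA le_sup_left hX hne
  refine ⟨A, X ⊔ K ∙ b, hA, hB, hne, hinf, ?_⟩
  refine Submodule.eq_of_le_of_finrank_eq (sup_le hAY (sup_le h
    ((Submodule.span_singleton_le_iff_mem _ _).2 hb))) ?_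
  rw [finrank_sup_of_finrank_inf hA hB (by rw [hinf, hX]), hY]

theorem exists_linearIndependent_span_eq {k : ℕ} {A : Submodule K V} (hA : finrank K A = k) :
    ∃ v : Fin k → V, LinearIndependent K v ∧ Submodule.span K (Set.range v) = A := by
  let b := finBasisOfFinrankEq K A hA
  refine ⟨fun i => b i, b.linearIndependent.map' A.subtype A.ker_subtype, ?_⟩
  have := congrArg (Submodule.map A.subtype) b.span_eq
  rwa [Submodule.map_span, ← Set.range_comp, Submodule.map_top, Submodule.range_subtype] at this

end Subspaces

/-! ### Decomposable vectors and lines through Plücker points -/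

section PluckerPoints

variable {K V : Type*} [Field K] [AddCommGroup V] [Module K V]

/-- The product is the wedge of the family extended by `u`, which vanishes exactly when that family
is dependent. This is how a subspace is read off its Plücker vector. -/
theorem ι_mul_ιMulti_eq_zero_iff {k : ℕ} {v : Fin k → V} (hv : LinearIndependent K v) (u : V) :
    ExteriorAlgebra.ι K u * (exteriorPower.ιMulti K k v : ExteriorAlgebra K V) = 0 ↔
      u ∈ Submodule.span K (Set.range v) := by
  have h1 : ExteriorAlgebra.ι K u * (exteriorPower.ιMulti K k v : ExteriorAlgebra K V) =
      (exteriorPower.ιMulti K (k + 1) (Fin.cons u v : Fin (k + 1) → V) : ExteriorAlgebra K V) := by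
    rw [exteriorPower.ιMulti_apply_coe, exteriorPower.ιMulti_apply_coe,
      ExteriorAlgebra.ιMulti_succ_apply]
    rfl
  rw [h1]
  constructor
  · intro h
    by_contra hu
    exact iotaMulti_ne_zero (linearIndependent_finCons.2 ⟨hv, hu⟩) (Subtype.ext h)
  · intro hu
    rw [AlternatingMap.map_linearDependent]
    · rfl
    · rw [linearIndependent_finCons]
      tauto

theorem ιMulti_cons_add {m : ℕ} (x : Fin m → V) (a b : V) (α β : K) :
    exteriorPower.ιMulti K (m + 1) (Fin.cons (α • a + β • b) x : Fin (m + 1) → V) =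
      α • exteriorPower.ιMulti K (m + 1) (Fin.cons a x : Fin (m + 1) → V) +
      β • exteriorPower.ιMulti K (m + 1) (Fin.cons b x : Fin (m + 1) → V) := by
  rw [← Matrix.vecCons, ← Matrix.vecCons, ← Matrix.vecCons, AlternatingMap.map_vecCons_add,
    AlternatingMap.map_vecCons_smul, AlternatingMap.map_vecCons_smul]

variable [FiniteDimensional K V] {k : ℕ}

theorem mem_iff_ι_mul_eq_zero {A : Submodule K V} {hA : finrank K A = k} {w : ⋀[K]^k V}
    {hw : w ≠ 0} (h : pluckerPoint A hA = .mk K w hw) (u : V) :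
    u ∈ A ↔ ExteriorAlgebra.ι K u * (w : ExteriorAlgebra K V) = 0 := by
  obtain ⟨v, hv, hvA⟩ := exists_linearIndependent_span_eq hA
  rw [pluckerPoint_eq A hA v hv fun i => hvA ▸ Submodule.subset_span ⟨i, rfl⟩,
    Projectivization.mk_eq_mk_iff'] at h
  obtain ⟨c, hc⟩ := h
  have hc0 : c ≠ 0 := by
    rintro rfl
    exact iotaMulti_ne_zero hv (by rw [← hc, zero_smul])
  rw [← hvA, ← ι_mul_ιMulti_eq_zero_iff hv, ← hc, Submodule.coe_smul, mul_smul_comm,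
    smul_eq_zero_iff_right hc0]

theorem pluckerPoint_inj {A B : Submodule K V} {hA : finrank K A = k} {hB : finrank K B = k}
    (h : pluckerPoint A hA = pluckerPoint B hB) : A = B := by
  ext u
  rw [mem_iff_ι_mul_eq_zero (Projectivization.mk_rep (pluckerPoint A hA)).symm,
    mem_iff_ι_mul_eq_zero (h.symm.trans (Projectivization.mk_rep (pluckerPoint A hA)).symm)]

/-- For `u` outside `A`, the vector `u ∧ w` represents `A ⊔ K ∙ u`, so this subspace is its
annihilator. -/
theorem mem_sup_span_singleton_iff_ι_mul_eq_zero {A : Submodule K V} {hA : finrank K A = k} {w : ⋀[K]^k V}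
    {hw : w ≠ 0} (h : pluckerPoint A hA = .mk K w hw) {u : V} (hu : u ∉ A) (x : V) :
    x ∈ A ⊔ K ∙ u ↔ ExteriorAlgebra.ι K x *
      (ExteriorAlgebra.ι K u * (w : ExteriorAlgebra K V)) = 0 := by
  obtain ⟨v, hv, hvA⟩ := exists_linearIndependent_span_eq hA
  rw [pluckerPoint_eq A hA v hv fun i => hvA ▸ Submodule.subset_span ⟨i, rfl⟩,
    Projectivization.mk_eq_mk_iff'] at h
  obtain ⟨c, hc⟩ := h
  have hc0 : c ≠ 0 := by
    rintro rfl
    exact iotaMulti_ne_zero hv (by rw [← hc, zero_smul])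
  have hLI := linearIndependent_finCons.2 ⟨hv, hvA ▸ hu⟩
  have h2 := ι_mul_ιMulti_eq_zero_iff hLI x
  rw [exteriorPower.ιMulti_apply_coe, ExteriorAlgebra.ιMulti_succ_apply, Fin.range_cons,
    Set.insert_eq, Submodule.span_union, hvA, sup_comm] at h2
  rw [← h2]
  change _ * (_ * (exteriorPower.ιMulti K k v : ExteriorAlgebra K V)) = 0 ↔ _
  rw [← hc, Submodule.coe_smul, mul_smul_comm, mul_smul_comm, smul_eq_zero_iff_right hc0]
  rfl

/-- If the sum of two decomposable vectors is decomposable, then the corresponding subspaces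
meet in a hyperplane of each. -/
theorem finrank_inf_of_add {A B C : Submodule K V} {hA : finrank K A = k} {hB : finrank K B = k}
    {hC : finrank K C = k} {w₁ w₂ : ⋀[K]^k V} {h₁ : w₁ ≠ 0} {h₂ : w₂ ≠ 0} {h₃ : w₁ + w₂ ≠ 0}
    (e₁ : pluckerPoint A hA = .mk K w₁ h₁) (e₂ : pluckerPoint B hB = .mk K w₂ h₂)
    (e₃ : pluckerPoint C hC = .mk K (w₁ + w₂) h₃) (hne : A ≠ B) :
    finrank K (A ⊓ B : Submodule K V) + 1 = k := by
  have hlt : finrank K (A ⊓ B : Submodule K V) < k := by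
    rw [← hA]
    refine Submodule.finrank_lt_finrank_of_lt (lt_of_le_of_ne inf_le_left fun h => hne ?_)
    exact Submodule.eq_of_le_of_finrank_eq (inf_eq_left.1 h) (by rw [hA, hB])
  -- `C` is too large to lie in `A ⊓ B`. Since `u` annihilates `w₁ + w₂`, the vectors `u ∧ w₁` and
  -- `u ∧ w₂` are opposite. Hence `u` lies outside both `A` and `B`, and `A ⊔ K ∙ u = B ⊔ K ∙ u` is
  -- a space of dimension `k + 1` containing `A ⊔ B`.
  obtain ⟨u, huC, hu⟩ : ∃ u ∈ C, u ∉ A ⊓ B := by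
    by_contra! h
    have := Submodule.finrank_mono (show C ≤ A ⊓ B from h)
    omega
  have hsum : ExteriorAlgebra.ι K u * (w₁ : ExteriorAlgebra K V) =
      -(ExteriorAlgebra.ι K u * (w₂ : ExteriorAlgebra K V)) := by
    rw [mem_iff_ι_mul_eq_zero e₃, Submodule.coe_add, mul_add] at huC
    exact eq_neg_of_add_eq_zero_left huC
  have hiff : u ∈ A ↔ u ∈ B := by
    rw [mem_iff_ι_mul_eq_zero e₁, mem_iff_ι_mul_eq_zero e₂, hsum, neg_eq_zero]
  have huA : u ∉ A := fun h => hu ⟨h, hiff.1 h⟩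
  have huB : u ∉ B := fun h => huA (hiff.2 h)
  have hsup : A ⊔ K ∙ u = B ⊔ K ∙ u := by
    ext x
    rw [mem_sup_span_singleton_iff_ι_mul_eq_zero e₁ huA, mem_sup_span_singleton_iff_ι_mul_eq_zero e₂ huB, hsum, mul_neg, neg_eq_zero]
  have hle : finrank K (A ⊔ B : Submodule K V) ≤ k + 1 := by
    rw [← hA, ← Submodule.finrank_sup_span_singleton huA]
    exact Submodule.finrank_mono (sup_le le_sup_left (hsup ▸ le_sup_left))
  have := Submodule.finrank_sup_add_finrank_inf_eq A B
  omega

/-- If every point of the line joining two distinct Plücker points is a Plücker point, then the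
corresponding subspaces meet in a hyperplane of each. -/
theorem finrank_inf_of_joinPoints {A B : Submodule K V} {hA : finrank K A = k}
    {hB : finrank K B = k} (hne : A ≠ B)
    (h : ∀ r ∈ joinPoints (pluckerPoint A hA) (pluckerPoint B hB),
      ∃ (C : Submodule K V) (hC : finrank K C = k), r = pluckerPoint C hC) :
    finrank K (A ⊓ B : Submodule K V) + 1 = k := by
  obtain ⟨w₁, n₁, e₁⟩ : ∃ w n, pluckerPoint A hA = .mk K w n :=
    ⟨_, _, (Projectivization.mk_rep _).symm⟩
  obtain ⟨w₂, n₂, e₂⟩ : ∃ w n, pluckerPoint B hB = .mk K w n :=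
    ⟨_, _, (Projectivization.mk_rep _).symm⟩
  have h₃ : w₁ + w₂ ≠ 0 := by
    intro h0
    apply hne
    apply pluckerPoint_inj (hA := hA) (hB := hB)
    rw [e₁, e₂, Projectivization.mk_eq_mk_iff']
    exact ⟨-1, by rw [neg_one_smul, eq_neg_of_add_eq_zero_left h0]⟩
  obtain ⟨C, hC, e₃⟩ := h (.mk K _ h₃) (by
    rw [e₁, e₂, mk_mem_joinPoints_mk]
    exact ⟨1, 1, by simp⟩)
  exact finrank_inf_of_add e₁ e₂ e₃.symm hne

theorem pluckerPoint_cons {m : ℕ} {X A : Submodule K V} {x : Fin m → V}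
    (hx : LinearIndependent K x) (hxX : Submodule.span K (Set.range x) = X) (hXA : X ≤ A)
    (hA : finrank K A = m + 1) {a : V} (ha : a ∈ A) (haX : a ∉ X) :
    pluckerPoint A hA = .mk K (exteriorPower.ιMulti K (m + 1) (Fin.cons a x : Fin (m + 1) → V))
      (iotaMulti_ne_zero (linearIndependent_finCons.2 ⟨hx, hxX.symm ▸ haX⟩)) := by
  refine pluckerPoint_eq A hA (Fin.cons a x : Fin (m + 1) → V)
    (linearIndependent_finCons.2 ⟨hx, hxX.symm ▸ haX⟩) (Fin.cases ?_ fun i => ?_)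
  · simpa using ha
  · simpa using hXA (hxX ▸ Submodule.subset_span ⟨i, rfl⟩)

/-- The scalar between two representatives is absorbed in the first factor. A representative
prescribed in advance, such as one in a Baer subgeometry, can thus be used without rescaling. -/
theorem exists_eq_mk_cons {m : ℕ} {X A : Submodule K V} {x : Fin m → V}
    (hx : LinearIndependent K x) (hxX : Submodule.span K (Set.range x) = X) (hXA : X ≤ A)
    (hA : finrank K A = m + 1) {w : ⋀[K]^(m + 1) V} {hw : w ≠ 0}
    (h : pluckerPoint A hA = .mk K w hw) :
    ∃ a ∈ A, a ∉ X ∧ w = exteriorPower.ιMulti K (m + 1) (Fin.cons a x : Fin (m + 1) → V) := by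
  obtain ⟨a, haA, haX⟩ := SetLike.exists_of_lt (lt_of_le_of_ne hXA (fun h' => by
    rw [← hxX] at h'
    rw [← h', finrank_span_eq_card hx, Fintype.card_fin] at hA
    omega))
  rw [pluckerPoint_cons hx hxX hXA hA haA haX, eq_comm, Projectivization.mk_eq_mk_iff'] at h
  obtain ⟨t, rfl⟩ := h
  have ht : t ≠ 0 := by
    rintro rfl
    simp at hw
  refine ⟨t • a, A.smul_mem _ haA, fun h' => haX ((Submodule.smul_mem_iff _ ht).1 h'), ?_⟩
  have := ιMulti_cons_add x a 0 t 0
  simpa using this.symm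

/-- The line joining the Plücker points of two subspaces meeting in a common hyperplane. -/
theorem joinPoints_pluckerPoint {A B : Submodule K V} {hA : finrank K A = k}
    {hB : finrank K B = k} (h : finrank K (A ⊓ B : Submodule K V) + 1 = k) :
    joinPoints (pluckerPoint A hA) (pluckerPoint B hB) =
      {r | ∃ (C : Submodule K V) (hC : finrank K C = k),
        A ⊓ B ≤ C ∧ C ≤ A ⊔ B ∧ r = pluckerPoint C hC} := by
  have hne := ne_of_finrank_inf hA h
  have hne' := ne_of_finrank_inf hB (inf_comm A B ▸ h)
  generalize hX : A ⊓ B = X at h ⊢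
  have hXA : X ≤ A := hX ▸ inf_le_left
  have hXB : X ≤ B := hX ▸ inf_le_right
  obtain ⟨a, haA, haX⟩ := SetLike.exists_of_lt
    (lt_of_le_of_ne hXA (fun h' => by rw [h'] at h; omega))
  obtain ⟨b, hbB, hbX⟩ := SetLike.exists_of_lt
    (lt_of_le_of_ne hXB (fun h' => by rw [h'] at h; omega))
  have hAe := sup_span_singleton_eq hXA (by omega) haA haX
  have hBe := sup_span_singleton_eq hXB (by omega) hbB hbX
  have hbA : b ∉ A := fun h' => hbX (hX ▸ ⟨h', hbB⟩)
  -- `a` and `b` are independent modulo `X`, so each non-zero combination spans, together with `X`,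
  -- a member of the pencil.
  have hcX : ∀ α β : K, α • a + β • b ∈ X → α = 0 ∧ β = 0 := by
    intro α β hc
    have hβ : β = 0 := by
      by_contra hβ
      apply hbA
      have h1 : β • b ∈ A := by
        have := A.sub_mem (hXA hc) (A.smul_mem α haA)
        rwa [add_sub_cancel_left] at this
      exact (Submodule.smul_mem_iff _ hβ).1 h1
    refine ⟨?_, hβ⟩
    by_contra hα
    rw [hβ, zero_smul, add_zero] at hc
    exact haX ((Submodule.smul_mem_iff _ hα).1 hc)
  obtain ⟨x, hx, hxX⟩ := exists_linearIndependent_span_eq (A := X) rfl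
  subst h
  have e₁ := pluckerPoint_cons hx hxX hXA hA haA haX
  have e₂ := pluckerPoint_cons hx hxX hXB hB hbB hbX
  ext r
  constructor
  · intro hr
    induction r using Projectivization.ind with
    | h v hv =>
      rw [e₁, e₂, mk_mem_joinPoints_mk] at hr
      obtain ⟨α, β, rfl⟩ := hr
      have hc : α • a + β • b ∉ X := by
        intro hc
        obtain ⟨rfl, rfl⟩ := hcX α β hc
        simp at hv
      refine ⟨X ⊔ K ∙ (α • a + β • b), Submodule.finrank_sup_span_singleton hc, le_sup_left,
        sup_le (hXA.trans le_sup_left) ?_, ?_⟩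
      · rw [Submodule.span_singleton_le_iff_mem]
        exact add_mem (Submodule.smul_mem _ _ (Submodule.mem_sup_left haA))
          (Submodule.smul_mem _ _ (Submodule.mem_sup_right hbB))
      · rw [pluckerPoint_cons hx hxX le_sup_left (Submodule.finrank_sup_span_singleton hc)
          (Submodule.mem_sup_right (Submodule.mem_span_singleton_self _)) hc]
        congr 1
        exact (ιMulti_cons_add x a b α β).symm
  · rintro ⟨C, hC, hXC, hCAB, rfl⟩
    obtain ⟨c, hcC, hcX'⟩ := SetLike.exists_of_lt
      (lt_of_le_of_ne hXC (fun h' => by rw [← h'] at hC; omega))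
    have hc := hCAB hcC
    rw [← hAe, ← hBe] at hc
    have hc' : c ∈ X ⊔ (K ∙ a ⊔ K ∙ b) := by
      refine (sup_le (sup_le le_sup_left ?_) (sup_le le_sup_left ?_) :
        (X ⊔ K ∙ a) ⊔ (X ⊔ K ∙ b) ≤ _) hc
      · exact le_sup_left.trans le_sup_right
      · exact le_sup_right.trans le_sup_right
    obtain ⟨x₀, hx₀, y, hy, rfl⟩ := Submodule.mem_sup.1 hc'
    rw [← Submodule.span_insert, Submodule.mem_span_pair] at hy
    -- The component `x₀` in `X` does not affect the wedge with a basis of `X`; only `α` and `β`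
    -- remain.
    obtain ⟨α, β, rfl⟩ := hy
    have hyC : α • a + β • b ∈ C := by
      have := C.sub_mem hcC (hXC hx₀)
      rwa [add_sub_cancel_left] at this
    have hyX : α • a + β • b ∉ X := fun h' => hcX' (add_mem hx₀ h')
    rw [pluckerPoint_cons hx hxX hXC hC hyC hyX, e₁, e₂, mk_mem_joinPoints_mk]
    exact ⟨α, β, (ιMulti_cons_add x a b α β).symm⟩

end PluckerPoints

/-! ### Features common to all systems of singular subspaces -/

section PolarSystems

variable {K V : Type*} [Field K] [AddCommGroup V] [Module K V]

/-- The properties shared by the sets of singular subspaces of all classical polar spaces: `f` is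
a reflexive form, members of `S` are totally isotropic, and `S` is closed under passing to
subspaces and under sums of orthogonal members. -/
structure IsPolarSystem {σ : K →+* K} (f : V →ₛₗ[σ] V →ₗ[K] K) (S : Set (Submodule K V)) :
    Prop where
  refl : ∀ x y, f x y = 0 → f y x = 0
  ortho : ∀ X ∈ S, ∀ x ∈ X, ∀ y ∈ X, f x y = 0
  mono : ∀ X ∈ S, ∀ Y ≤ X, Y ∈ S
  sup : ∀ X ∈ S, ∀ Y ∈ S, (∀ x ∈ X, ∀ y ∈ Y, f x y = 0) → X ⊔ Y ∈ S

/-- With the zero form every subspace is singular, so projective grassmannians fall under the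
general bound on distances. -/
theorem isPolarSystem_univ :
    IsPolarSystem (0 : V →ₗ[K] V →ₗ[K] K) (Set.univ : Set (Submodule K V)) :=
  ⟨by simp, by simp, by simp, by simp⟩

theorem isPolarSystem_isotropicSubspaces {σ : K →+* K} {f : V →ₛₗ[σ] V →ₗ[K] K}
    (h : ∀ x y, f x y = 0 → f y x = 0) : IsPolarSystem f (isotropicSubspaces f) where
  refl := h
  ortho X hX := hX
  mono X hX Y hY x hx y hy := hX x (hY hx) y (hY hy)
  sup X hX Y hY hXY u hu v hv := by
    obtain ⟨x, hx, y, hy, rfl⟩ := Submodule.mem_sup.1 hu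
    obtain ⟨x', hx', y', hy', rfl⟩ := Submodule.mem_sup.1 hv
    simp [hX x hx x' hx', hY y hy y' hy', hXY x hx y' hy', h _ _ (hXY x' hx' y hy)]

theorem IsSymplecticForm.isPolarSystem {f : V →ₗ[K] V →ₗ[K] K} (h : IsSymplecticForm f) :
    IsPolarSystem f (isotropicSubspaces f) :=
  isPolarSystem_isotropicSubspaces fun x y hxy => h.1.isRefl x y hxy

theorem IsHermitianForm.isPolarSystem {σ : K →+* K} {f : V →ₛₗ[σ] V →ₗ[K] K}
    (h : IsHermitianForm σ f) : IsPolarSystem f (isotropicSubspaces f) :=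
  isPolarSystem_isotropicSubspaces fun x y hxy => by rw [← h.2.2.1, hxy, map_zero]

/-- The polar form only measures orthogonality. Membership is decided by `q`, which in
characteristic two is a stronger condition than isotropy. -/
theorem isPolarSystem_singularSubspaces (q : QuadraticForm K V) :
    IsPolarSystem (QuadraticMap.polarBilin q) (singularSubspaces q) where
  refl x y hxy := by
    rw [QuadraticMap.polarBilin_apply_apply] at hxy ⊢
    rw [QuadraticMap.polar_comm, hxy]
  ortho X hX x hx y hy := by
    rw [QuadraticMap.polarBilin_apply_apply, QuadraticMap.polar, hX _ (add_mem hx hy), hX x hx,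
      hX y hy]
    simp
  mono X hX Y hY x hx := hX x (hY hx)
  sup X hX Y hY hXY u hu := by
    obtain ⟨x, hx, y, hy, rfl⟩ := Submodule.mem_sup.1 hu
    have := hXY x hx y hy
    rw [QuadraticMap.polarBilin_apply_apply, QuadraticMap.polar, hX x hx, hY y hy] at this
    simpa using this

theorem IsPolarSystem.sup_span_singleton_mem {σ : K →+* K} {f : V →ₛₗ[σ] V →ₗ[K] K}
    {S : Set (Submodule K V)} (hS : IsPolarSystem f S) {X B : Submodule K V} (hX : X ∈ S)
    (hB : B ∈ S) {b : V} (hb : b ∈ B) (h : ∀ x ∈ X, f x b = 0) : X ⊔ K ∙ b ∈ S := by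
  refine hS.sup X hX _ (hS.mono B hB _ ((Submodule.span_singleton_le_iff_mem _ _).2 hb)) ?_
  intro x hx y hy
  obtain ⟨c, rfl⟩ := Submodule.mem_span_singleton.1 hy
  simp [h x hx]

variable [FiniteDimensional K V]

theorem finrank_le_finrank_inf_ker_add_one (A : Submodule K V) (φ : V →ₗ[K] K) :
    finrank K A ≤ finrank K (A ⊓ LinearMap.ker φ : Submodule K V) + 1 := by
  have h1 := Submodule.finrank_sup_add_finrank_inf_eq A (LinearMap.ker φ)
  have h2 := φ.finrank_range_add_finrank_ker
  have h3 := Submodule.finrank_le (LinearMap.range φ)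
  have h4 := Submodule.finrank_le (A ⊔ LinearMap.ker φ)
  rw [finrank_self] at h3
  omega

namespace IsPolarSystem

variable {σ : K →+* K} {f : V →ₛₗ[σ] V →ₗ[K] K} {S : Set (Submodule K V)}

/-- A singular subspace can be moved closer to another one by replacing a hyperplane. -/
theorem exists_closer (hS : IsPolarSystem f S) {A B : Submodule K V} (hA : A ∈ S) (hB : B ∈ S)
    (hBA : ¬ B ≤ A) (hAB : ¬ A ≤ B) :
    ∃ Z ∈ S, finrank K Z = finrank K A ∧
      finrank K (A ⊓ Z : Submodule K V) + 1 = finrank K A ∧ A ⊓ B < Z ⊓ B := by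
  obtain ⟨b, hb, hbA⟩ := SetLike.not_le_iff_exists.1 hBA
  have hlt : A ⊓ B < A := lt_of_le_of_ne inf_le_left fun h => hAB (inf_eq_left.1 h)
  have hlt' := Submodule.finrank_lt_finrank_of_lt hlt
  have hker := finrank_le_finrank_inf_ker_add_one A (f b)
  -- `X` is a hyperplane of `A` that contains `A ⊓ B` and is orthogonal to `b`. It exists because `A
  -- ⊓ B` is orthogonal to `b ∈ B`, and the orthogonal of `b` cuts the dimension of `A` by at most
  -- one. The new subspace is `X ⊔ K ∙ b`.
  obtain ⟨X, hX, hXA, hXd⟩ := exists_between_finrank_eq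
    (X := A ⊓ B) (Y := A ⊓ LinearMap.ker (f b)) (j := finrank K A - 1)
    (le_inf inf_le_left fun x hx => hS.ortho B hB b hb x hx.2) (by omega) (by omega)
  have hbX : b ∉ X := fun h => hbA (hXA h).1
  have hbZ : b ∈ X ⊔ K ∙ b := Submodule.mem_sup_right (Submodule.mem_span_singleton_self b)
  have hd : finrank K (X ⊔ K ∙ b : Submodule K V) = finrank K A := by
    rw [Submodule.finrank_sup_span_singleton hbX]
    omega
  refine ⟨X ⊔ K ∙ b, ?_, hd, ?_, ?_⟩
  · exact hS.sup_span_singleton_mem (hS.mono A hA _ (hXA.trans inf_le_left)) hB hb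
      fun x hx => hS.refl _ _ (hXA hx).2
  · rw [inf_eq_of_finrank rfl hd (hXA.trans inf_le_left) le_sup_left (by omega)
      fun h => hbA (h ▸ hbZ)]
    omega
  · refine lt_of_le_of_ne (le_inf (hX.trans le_sup_left) inf_le_right) fun h => hbA ?_
    exact (h.ge ⟨hbZ, hb⟩ : b ∈ A ⊓ B).1

/-- Every singular subspace is contained in one of maximal dimension. -/
theorem exists_ge_finrank_eq (hS : IsPolarSystem f S) {n : ℕ} (hn : HasPolarRank S n)
    {X : Submodule K V} (hX : X ∈ S) : ∃ M ∈ S, X ≤ M ∧ finrank K M = n := by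
  obtain ⟨⟨M, hM, hMn⟩, hmax⟩ := hn
  -- A subspace `M` of maximal dimension is moved towards `X` until it contains `X`.
  induction hd : finrank K X - finrank K (M ⊓ X : Submodule K V)
    using Nat.strong_induction_on generalizing M with
  | _ d ih =>
    by_cases hXM : X ≤ M
    · exact ⟨M, hM, hXM, hMn⟩
    have hMX : ¬ M ≤ X := fun h =>
      hXM (Submodule.eq_of_le_of_finrank_le h (hMn ▸ hmax X hX)).ge
    obtain ⟨Z, hZ, hZn, -, hlt⟩ := hS.exists_closer hM hX hXM hMX
    have h1 := Submodule.finrank_lt_finrank_of_lt hlt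
    have h2 := Submodule.finrank_mono (inf_le_right : Z ⊓ X ≤ X)
    exact ih _ (by omega) Z hZ (by omega) rfl

theorem nonempty_polarPoint (hS : IsPolarSystem f S) {n k : ℕ} (hn : HasPolarRank S n)
    (hk : k ≤ n) : Nonempty (PolarPoint S k) := by
  obtain ⟨⟨M, hM, hMn⟩, -⟩ := hn
  obtain ⟨Z, -, hZM, hZ⟩ := exists_between_finrank_eq (bot_le : ⊥ ≤ M) (j := k) (by simp)
    (by omega)
  exact ⟨⟨Z, hS.mono M hM Z hZM, hZ⟩⟩

/-- A bound on distances, given a bound on the distances of subspaces meeting in hyperplanes. -/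
theorem edist_le (hS : IsPolarSystem f S) {k c : ℕ} {P : Type*} (G : SimpleGraph P)
    (s : P → Submodule K V) (hs : Function.Injective s)
    (hP : ∀ Z, Z ∈ S ∧ finrank K Z = k ↔ ∃ p, s p = Z)
    (h : ∀ p r, finrank K (s p ⊓ s r : Submodule K V) + 1 = k → G.edist p r ≤ c) (p r : P) :
    G.edist p r ≤ ((c * k : ℕ) : ℕ∞) := by
  refine (edist_le_of_forall_exists_lt G c r
    (fun p => k - finrank K (s p ⊓ s r : Submodule K V)) (fun p hpr => ?_) p).trans
    (by exact_mod_cast Nat.mul_le_mul_left c (Nat.sub_le _ _))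
  have hp := (hP _).2 ⟨p, rfl⟩
  have hr := (hP _).2 ⟨r, rfl⟩
  have hrp : ¬ s r ≤ s p := fun hle =>
    hpr (hs (Submodule.eq_of_le_of_finrank_eq hle (by omega)).symm)
  have hpr' : ¬ s p ≤ s r := fun hle =>
    hpr (hs (Submodule.eq_of_le_of_finrank_eq hle (by omega)))
  obtain ⟨Z, hZ, hZk, hd, hlt⟩ := hS.exists_closer hp.1 hr.1 hrp hpr'
  obtain ⟨z, rfl⟩ := (hP Z).1 ⟨hZ, by omega⟩
  refine ⟨z, h p z (by omega), ?_⟩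
  have h1 := Submodule.finrank_lt_finrank_of_lt hlt
  have h2 := Submodule.finrank_mono (inf_le_left : s z ⊓ s r ≤ s z)
  change k - finrank K (s z ⊓ s r : Submodule K V) < k - finrank K (s p ⊓ s r : Submodule K V)
  omega

end IsPolarSystem

end PolarSystems

/-! ### Projective grassmannians -/

section ProjectiveGrassmannians

variable {K V : Type*} [Field K] [AddCommGroup V] [Module K V] [FiniteDimensional K V]

theorem exists_mem_lines_projGrassmannian {k : ℕ} (A B : GrassPoint K V k)
    (h : finrank K (A.1 ⊓ B.1 : Submodule K V) + 1 = k) :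
    ∃ l ∈ (projGrassmannian K V k).lines, A ∈ l ∧ B ∈ l :=
  ⟨{Z | A.1 ⊓ B.1 ≤ Z.1 ∧ Z.1 ≤ A.1 ⊔ B.1},
    ⟨_, _, inf_le_sup, h, finrank_sup_of_finrank_inf A.2 B.2 h, rfl⟩,
    ⟨inf_le_left, le_sup_left⟩, ⟨inf_le_right, le_sup_right⟩⟩

theorem projGrassmannian_isAdmissible {k : ℕ} (hk : k ≤ finrank K V) :
    (projGrassmannian K V k).IsAdmissible := by
  have : Nonempty (GrassPoint K V k) := by
    obtain ⟨Z, -, -, hZ⟩ := exists_between_finrank_eq (bot_le : (⊥ : Submodule K V) ≤ ⊤)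
      (j := k) (by simp) (by simpa using hk)
    exact ⟨⟨Z, hZ⟩⟩
  refine .of_edist_le (1 * k) ?_ ?_
  · refine isPolarSystem_univ.edist_le _ (fun Z : GrassPoint K V k => Z.1)
      Subtype.val_injective ?_ ?_
    · exact fun Z => ⟨fun h => ⟨⟨Z, h.2⟩, rfl⟩, by rintro ⟨p, rfl⟩; exact ⟨trivial, p.2⟩⟩
    · intro p r h
      have hadj : (projGrassmannian K V k).collinearityGraph.Adj p r :=
        ⟨fun h' => ne_of_finrank_inf p.2 h (congrArg Subtype.val h'),
          exists_mem_lines_projGrassmannian p r h⟩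
      exact_mod_cast (SimpleGraph.edist_eq_one_iff_adj.2 hadj).le
  · rintro l ⟨X, Y, -, hX, hY, rfl⟩ m ⟨X', Y', -, hX', hY', rfl⟩ x y hxy hx hy hx' hy'
    have hne : x.1 ≠ y.1 := fun h => hxy (Subtype.ext h)
    have h1 := inf_eq_of_finrank x.2 y.2 hx.1 hy.1 hX hne
    have h2 := inf_eq_of_finrank x.2 y.2 hx'.1 hy'.1 hX' hne
    have hd := finrank_sup_of_finrank_inf x.2 y.2 (h1 ▸ hX)
    have h3 := Submodule.eq_of_le_of_finrank_eq (sup_le hx.2 hy.2) (hd.trans hY.symm)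
    have h4 := Submodule.eq_of_le_of_finrank_eq (sup_le hx'.2 hy'.2) (hd.trans hY'.symm)
    rw [← h1, ← h2, ← h3, ← h4]

theorem iSup_projPlucker (k : ℕ) : ⨆ Z, (projPlucker K V k Z).submodule = ⊤ := by
  rw [eq_top_iff, ← exteriorPower.ιMulti_span, Submodule.span_le]
  rintro _ ⟨v, rfl⟩
  by_cases hv : LinearIndependent K v
  · have hd : finrank K (Submodule.span K (Set.range v)) = k := by
      rw [finrank_span_eq_card hv, Fintype.card_fin]
    have h1 : (projPlucker K V k ⟨_, hd⟩).submodule ≤ _ :=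
      le_iSup (fun Z => (projPlucker K V k Z).submodule) ⟨_, hd⟩
    rw [projPlucker, pluckerPoint_eq _ hd v hv fun i => Submodule.subset_span ⟨i, rfl⟩,
      Projectivization.submodule_mk] at h1
    exact h1 (Submodule.mem_span_singleton_self _)
  · rw [AlternatingMap.map_linearDependent _ _ hv]
    exact zero_mem _

theorem isTransparent_projPlucker {k : ℕ} (hk : k ≤ finrank K V) :
    IsTransparent (projGrassmannian K V k) (projPlucker K V k) := by
  refine (IsProjectiveEmbedding.of_joinPoints (projGrassmannian_isAdmissible hk)
    (fun A B h => Subtype.ext (pluckerPoint_inj h)) (iSup_projPlucker k) ?_).isTransparent ?_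
  · rintro _ ⟨X, Y, hXY, hX, hY, rfl⟩
    obtain ⟨A, B, hA, hB, hne, rfl, rfl⟩ := exists_pair_between hXY hX hY
    refine ⟨⟨A, hA⟩, ⟨B, hB⟩, fun h => hne (congrArg Subtype.val h), ?_⟩
    refine Eq.trans ?_ (joinPoints_pluckerPoint hX).symm
    ext r
    constructor
    · rintro ⟨C, hC, rfl⟩
      exact ⟨C.1, C.2, hC.1, hC.2, rfl⟩
    · rintro ⟨C, hC, h1, h2, rfl⟩
      exact ⟨⟨C, hC⟩, ⟨h1, h2⟩, rfl⟩
  · intro A B hne h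
    refine exists_mem_lines_projGrassmannian A B (finrank_inf_of_joinPoints (hA := A.2)
      (hB := B.2) (fun h' => hne (Subtype.ext h')) fun r hr => ?_)
    obtain ⟨C, rfl⟩ := h hr
    exact ⟨C.1, C.2, rfl⟩

end ProjectiveGrassmannians

/-! ### Polar grassmannians and the quadratic and hermitian cases with `k < n` -/

section PolarGrassmannians

variable {K V : Type*} [Field K] [AddCommGroup V] [Module K V] [FiniteDimensional K V]
  {σ : K →+* K} {f : V →ₛₗ[σ] V →ₗ[K] K} {S : Set (Submodule K V)} {n k : ℕ}

namespace IsPolarSystem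

theorem adj_of_sup_mem (hS : IsPolarSystem f S) (hk : k < n) {A B : PolarPoint S k}
    (h : finrank K (A.1 ⊓ B.1 : Submodule K V) + 1 = k) (hAB : A.1 ⊔ B.1 ∈ S) :
    (polarGrassmannian S n k).collinearityGraph.Adj A B :=
  ⟨fun h' => ne_of_finrank_inf A.2.2 h (congrArg Subtype.val h'),
    {Z | A.1 ⊓ B.1 ≤ Z.1 ∧ Z.1 ≤ A.1 ⊔ B.1},
    Or.inl ⟨hk, _, hS.mono _ A.2.1 _ inf_le_left, _, hAB, inf_le_sup, h,
      finrank_sup_of_finrank_inf A.2.2 B.2.2 h, rfl⟩,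
    ⟨inf_le_left, le_sup_left⟩, ⟨inf_le_right, le_sup_right⟩⟩

theorem finrank_inf_of_adj {A B : PolarPoint S k}
    (h : (polarGrassmannian S n k).collinearityGraph.Adj A B) :
    finrank K (A.1 ⊓ B.1 : Submodule K V) + 1 = k ∧ (k < n → A.1 ⊔ B.1 ∈ S) := by
  obtain ⟨hne, l, hl, hA, hB⟩ := h
  have hne' : A.1 ≠ B.1 := fun h => hne (Subtype.ext h)
  rcases hl with ⟨hk, X, hXS, Y, hYS, hXY, hX, hY, rfl⟩ | ⟨hk, X, hXS, hX, rfl⟩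
  · have h1 := inf_eq_of_finrank A.2.2 B.2.2 hA.1 hB.1 hX hne'
    rw [← h1] at hX
    have h2 := Submodule.eq_of_le_of_finrank_eq (sup_le hA.2 hB.2)
      ((finrank_sup_of_finrank_inf A.2.2 B.2.2 hX).trans hY.symm)
    exact ⟨hX, fun _ => h2 ▸ hYS⟩
  · exact ⟨inf_eq_of_finrank A.2.2 B.2.2 hA hB hX hne' ▸ hX, fun h => absurd hk h.ne⟩

omit [FiniteDimensional K V] in
theorem adj_of_finrank_inf (hS : IsPolarSystem f S) {A B : PolarPoint S n}
    (h : finrank K (A.1 ⊓ B.1 : Submodule K V) + 1 = n) :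
    (polarGrassmannian S n n).collinearityGraph.Adj A B :=
  ⟨fun h' => ne_of_finrank_inf A.2.2 h (congrArg Subtype.val h'), {Z | A.1 ⊓ B.1 ≤ Z.1},
    Or.inr ⟨rfl, _, hS.mono _ A.2.1 _ inf_le_left, h, rfl⟩,
    inf_le_left (a := A.1), inf_le_right (a := A.1)⟩

/-- Suppose `A ⊔ B` is not singular, and let `M` be a maximal singular subspace through `A` and `b ∈
B` a vector outside `A`. The vectors of `M` orthogonal to `b` form a space of dimension at least `n
- 1 ≥ k`, so one of them, `c`, is outside `A ⊓ B`. Then `A ⊓ B ⊔ K ∙ c` is collinear with `A` inside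
`M`, and with `B` because it is orthogonal to `b`. -/
theorem edist_le_two (hS : IsPolarSystem f S) (hn : HasPolarRank S n) (hk : k < n)
    {A B : PolarPoint S k} (h : finrank K (A.1 ⊓ B.1 : Submodule K V) + 1 = k) :
    (polarGrassmannian S n k).collinearityGraph.edist A B ≤ 2 := by
  by_cases hAB : A.1 ⊔ B.1 ∈ S
  · rw [SimpleGraph.edist_eq_one_iff_adj.2 (hS.adj_of_sup_mem hk h hAB)]
    norm_num
  obtain ⟨A, hAS, hA⟩ := A
  obtain ⟨B, hBS, hB⟩ := B
  simp only at h hAB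
  have hBA : ¬ B ≤ A := fun h' => hAB (by rwa [sup_eq_left.2 h'])
  obtain ⟨b, hbB, hbA⟩ := SetLike.not_le_iff_exists.1 hBA
  have hXb : A ⊓ B ⊔ K ∙ b = B := sup_span_singleton_eq inf_le_right (by omega) hbB
    fun h' => hbA h'.1
  -- This `a` separates the intermediate point from both ends: that point is orthogonal to `b`,
  -- unlike `A`, and it lies in `M`, hence is orthogonal to `a`, unlike `B`.
  have hab : ∃ a ∈ A, f a b ≠ 0 := by
    by_contra! h0
    refine hAB ?_
    have := hS.sup_span_singleton_mem hAS hBS hbB h0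
    rwa [← hXb, ← sup_assoc, sup_eq_left.2 (inf_le_left : A ⊓ B ≤ A)]
  obtain ⟨a, haA, hab⟩ := hab
  obtain ⟨M, hMS, hAM, hMn⟩ := hS.exists_ge_finrank_eq hn hAS
  have hker := finrank_le_finrank_inf_ker_add_one M (f b)
  obtain ⟨c, ⟨hcM, hcb⟩, hcX⟩ : ∃ c ∈ M ⊓ LinearMap.ker (f b), c ∉ A ⊓ B := by
    by_contra! h'
    have := Submodule.finrank_mono (show M ⊓ LinearMap.ker (f b) ≤ A ⊓ B from h')
    omega
  have hcb' : f c b = 0 := hS.refl _ _ hcb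
  have hCM : A ⊓ B ⊔ K ∙ c ≤ M := sup_le (inf_le_left.trans hAM)
    ((Submodule.span_singleton_le_iff_mem _ _).2 hcM)
  have hCd : finrank K (A ⊓ B ⊔ K ∙ c : Submodule K V) = k := by
    rw [Submodule.finrank_sup_span_singleton hcX, h]
  have hCb : ∀ x ∈ A ⊓ B ⊔ K ∙ c, f x b = 0 := by
    intro x hx
    obtain ⟨y, hy, z, hz, rfl⟩ := Submodule.mem_sup.1 hx
    obtain ⟨t, rfl⟩ := Submodule.mem_span_singleton.1 hz
    simp [hcb', hS.ortho B hBS _ hy.2 _ hbB]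
  have hCS : A ⊓ B ⊔ K ∙ c ∈ S := hS.mono M hMS _ hCM
  have hAC : A ≠ A ⊓ B ⊔ K ∙ c := fun h' => hab (hCb a (h' ▸ haA))
  have hBC : B ≠ A ⊓ B ⊔ K ∙ c := fun h' => hab
    (hS.ortho M hMS _ (hAM haA) _ (hCM (h' ▸ hbB)))
  have h1 : (polarGrassmannian S n k).collinearityGraph.Adj ⟨A, hAS, hA⟩ ⟨_, hCS, hCd⟩ := by
    refine hS.adj_of_sup_mem hk ?_ (hS.mono M hMS _ (sup_le hAM hCM))
    rw [inf_eq_of_finrank hA hCd inf_le_left le_sup_left h hAC, h]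
  have h2 : (polarGrassmannian S n k).collinearityGraph.Adj ⟨B, hBS, hB⟩ ⟨_, hCS, hCd⟩ := by
    refine hS.adj_of_sup_mem hk ?_ ?_
    · rw [inf_eq_of_finrank hB hCd inf_le_right le_sup_left h hBC, h]
    · have := hS.sup_span_singleton_mem hCS hBS hbB hCb
      refine hS.mono _ this _ (sup_le ?_ le_sup_left)
      exact hXb.ge.trans (sup_le (le_sup_left.trans le_sup_left) le_sup_right)
  refine (SimpleGraph.edist_le (.cons h1 (.cons h2.symm .nil))).trans ?_
  norm_num

theorem isAdmissible_of_lt (hS : IsPolarSystem f S) (hn : HasPolarRank S n) (hk : k < n) :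
    (polarGrassmannian S n k).IsAdmissible := by
  have := hS.nonempty_polarPoint hn hk.le
  -- At most `k` replacements of a hyperplane are needed, each at distance at most two.
  refine .of_edist_le (2 * k) ?_ ?_
  · refine hS.edist_le _ (fun Z : PolarPoint S k => Z.1) Subtype.val_injective ?_ ?_
    · exact fun Z => ⟨fun h => ⟨⟨Z, h⟩, rfl⟩, by rintro ⟨p, rfl⟩; exact p.2⟩
    · exact fun p r h => hS.edist_le_two hn hk h
  · rintro l (⟨-, X, -, Y, -, -, hX, hY, rfl⟩ | ⟨h, -⟩)
      m (⟨-, X', -, Y', -, -, hX', hY', rfl⟩ | ⟨h', -⟩) x y hxy hx hy hx' hy'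
    · have hne : x.1 ≠ y.1 := fun h => hxy (Subtype.ext h)
      have h1 := inf_eq_of_finrank x.2.2 y.2.2 hx.1 hy.1 hX hne
      have h2 := inf_eq_of_finrank x.2.2 y.2.2 hx'.1 hy'.1 hX' hne
      have hd := finrank_sup_of_finrank_inf x.2.2 y.2.2 (h1 ▸ hX)
      have h3 := Submodule.eq_of_le_of_finrank_eq (sup_le hx.2 hy.2) (hd.trans hY.symm)
      have h4 := Submodule.eq_of_le_of_finrank_eq (sup_le hx'.2 hy'.2) (hd.trans hY'.symm)
      rw [← h1, ← h2, ← h3, ← h4]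
    all_goals omega

theorem isAdmissible_dual (hS : IsPolarSystem f S) (hn : HasPolarRank S n) :
    (polarGrassmannian S n n).IsAdmissible := by
  have := hS.nonempty_polarPoint hn le_rfl
  refine .of_edist_le (1 * n) ?_ ?_
  · refine hS.edist_le _ (fun Z : PolarPoint S n => Z.1) Subtype.val_injective ?_ ?_
    · exact fun Z => ⟨fun h => ⟨⟨Z, h⟩, rfl⟩, by rintro ⟨p, rfl⟩; exact p.2⟩
    · intro p r h
      exact_mod_cast (SimpleGraph.edist_eq_one_iff_adj.2 (hS.adj_of_finrank_inf h)).le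
  · rintro l (⟨h, -⟩ | ⟨-, X, -, hX, rfl⟩) m (⟨h', -⟩ | ⟨-, X', -, hX', rfl⟩) x y hxy hx hy hx' hy'
    iterate 3 omega
    have hne : x.1 ≠ y.1 := fun h => hxy (Subtype.ext h)
    rw [← inf_eq_of_finrank x.2.2 y.2.2 hx hy hX hne,
      ← inf_eq_of_finrank x.2.2 y.2.2 hx' hy' hX' hne]

theorem polarPluckerMap_injective :
    Function.Injective (polarPluckerMap S k) :=
  fun _ _ h => Subtype.ext (pluckerPoint_inj h)

/-- The Plücker map sends the lines of the polar `k`-grassmannian, `k < n`, to full lines. -/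
theorem exists_image_eq_joinPoints (hS : IsPolarSystem f S) (hk : k < n)
    {l : Set (PolarPoint S k)} (hl : l ∈ (polarGrassmannian S n k).lines) :
    ∃ A B, A ≠ B ∧ polarPluckerMap S k '' l =
      joinPoints (polarPluckerMap S k A) (polarPluckerMap S k B) := by
  rcases hl with ⟨-, X, -, Y, hY, hXY, hXd, hYd, rfl⟩ | ⟨h, -⟩
  · obtain ⟨A, B, hA, hB, hne, rfl, rfl⟩ := exists_pair_between hXY hXd hYd
    refine ⟨⟨A, hS.mono _ hY _ le_sup_left, hA⟩, ⟨B, hS.mono _ hY _ le_sup_right, hB⟩,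
      fun h => hne (congrArg Subtype.val h), ?_⟩
    rw [polarPluckerMap, polarPluckerMap, joinPoints_pluckerPoint hXd]
    ext r
    constructor
    · rintro ⟨C, hC, rfl⟩
      exact ⟨C.1, C.2.2, hC.1, hC.2, rfl⟩
    · rintro ⟨C, hC, h1, h2, rfl⟩
      exact ⟨⟨C, hS.mono _ hY _ h2, hC⟩, ⟨h1, h2⟩, rfl⟩
  · omega

/-- With its converse `joinPoints_subset_of_forall`, this turns opacity into linear algebra: the
whole pencil spanned by `A` and `B` must be singular. -/
theorem finrank_inf_of_joinPoints_subset {A B : PolarPoint S k} (hne : A ≠ B)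
    (h : joinPoints (polarPluckerMap S k A) (polarPluckerMap S k B) ⊆
      Set.range (polarPluckerMap S k)) :
    finrank K (A.1 ⊓ B.1 : Submodule K V) + 1 = k ∧
      ∀ C : Submodule K V, finrank K C = k → A.1 ⊓ B.1 ≤ C → C ≤ A.1 ⊔ B.1 → C ∈ S := by
  have hd := finrank_inf_of_joinPoints (hA := A.2.2) (hB := B.2.2)
      (fun h' => hne (Subtype.ext h')) fun r hr => by
        obtain ⟨C, rfl⟩ := h hr
        exact ⟨C.1, C.2.2, rfl⟩
  refine ⟨hd, fun C hC h1 h2 => ?_⟩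
  have hr : pluckerPoint C hC ∈ joinPoints (polarPluckerMap S k A) (polarPluckerMap S k B) := by
    rw [polarPluckerMap, polarPluckerMap, joinPoints_pluckerPoint hd]
    exact ⟨C, hC, h1, h2, rfl⟩
  obtain ⟨D, hD⟩ := h hr
  rw [← pluckerPoint_inj hD]
  exact D.2.1

theorem joinPoints_subset_of_forall {A B : PolarPoint S k}
    (hd : finrank K (A.1 ⊓ B.1 : Submodule K V) + 1 = k)
    (h : ∀ C : Submodule K V, finrank K C = k → A.1 ⊓ B.1 ≤ C → C ≤ A.1 ⊔ B.1 → C ∈ S) :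
    joinPoints (polarPluckerMap S k A) (polarPluckerMap S k B) ⊆
      Set.range (polarPluckerMap S k) := by
  rw [polarPluckerMap, polarPluckerMap, joinPoints_pluckerPoint hd]
  rintro _ ⟨C, hC, h1, h2, rfl⟩
  exact ⟨⟨C, h C hC h1 h2, hC⟩, rfl⟩

theorem isProjectiveEmbedding_of_lt (hS : IsPolarSystem f S) (hn : HasPolarRank S n)
    (hk : k < n) : IsProjectiveEmbedding (polarGrassmannian S n k) (polarPlucker S k) := by
  refine .of_joinPoints (hS.isAdmissible_of_lt hn hk)
    (toImageSpan_injective _ polarPluckerMap_injective) (iSup_toImageSpan _) fun l hl => ?_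
  obtain ⟨A, B, hne, h⟩ := hS.exists_image_eq_joinPoints hk hl
  exact ⟨A, B, hne, (image_toImageSpan_eq_joinPoints _ _ _ _).2 h⟩

/-- Transparency for polar spaces such that a subspace is singular as soon as all its points
are singular. -/
theorem isTransparent_of_lt (hS : IsPolarSystem f S)
    (hpts : ∀ Y : Submodule K V, (∀ y ∈ Y, K ∙ y ∈ S) → Y ∈ S) (hn : HasPolarRank S n)
    (hk : k < n) : IsTransparent (polarGrassmannian S n k) (polarPlucker S k) := by
  refine (hS.isProjectiveEmbedding_of_lt hn hk).isTransparent fun A B hne h => ?_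
  obtain ⟨hd, hC⟩ := finrank_inf_of_joinPoints_subset hne
    ((joinPoints_toImageSpan_subset_range _ _ _).1 h)
  refine (hS.adj_of_sup_mem hk hd (hpts _ fun y hy => ?_)).2
  -- The pencil covers `A ⊔ B`: each `y` lies in some member. The lower end has dimension `k - 1` or
  -- `k` according to whether `y` lies in `A ⊓ B`.
  obtain ⟨C, hXC, hCY, hCk⟩ := exists_between_finrank_eq (X := A.1 ⊓ B.1 ⊔ K ∙ y)
    (Y := A.1 ⊔ B.1) (j := k)
    (sup_le inf_le_sup ((Submodule.span_singleton_le_iff_mem _ _).2 hy))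
    (by
      by_cases hyX : y ∈ A.1 ⊓ B.1
      · rw [sup_eq_left.2 ((Submodule.span_singleton_le_iff_mem _ _).2 hyX)]
        omega
      · rw [Submodule.finrank_sup_span_singleton hyX, hd])
    (by rw [finrank_sup_of_finrank_inf A.2.2 B.2.2 hd]; omega)
  exact hS.mono C (hC C hCk (le_sup_left.trans hXC) hCY) _ (le_sup_right.trans hXC)

end IsPolarSystem

theorem isTransparent_quadratic {q : QuadraticForm K V} (hn : HasPolarRank (singularSubspaces q) n)
    (hk : k < n) : IsTransparent (polarGrassmannian (singularSubspaces q) n k)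
      (polarPlucker (singularSubspaces q) k) :=
  (isPolarSystem_singularSubspaces q).isTransparent_of_lt
    (fun _ hY y hy => hY y hy y (Submodule.mem_span_singleton_self y)) hn hk

-- Expanding `f (x + t y) (x + t y) = 0` gives `t * f x y + σ t * σ (f x y) = 0`. The case `t = 1`
-- yields `σ (f x y) = -f x y`, whence `(t - σ t) * f x y = 0` for all `t`, and `σ` is not the
-- identity. Nothing is divided by two.
omit [FiniteDimensional K V] in
theorem IsHermitianForm.apply_eq_zero_of_forall_apply_self (hf : IsHermitianForm σ f)
    {Y : Submodule K V} (hY : ∀ y ∈ Y, f y y = 0) {x y : V} (hx : x ∈ Y) (hy : y ∈ Y) :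
    f x y = 0 := by
  have h1 : ∀ t : K, t * f x y + σ t * σ (f x y) = 0 := by
    intro t
    have := hY _ (add_mem hx (Y.smul_mem t hy))
    simpa [hY x hx, hY y hy, ← hf.2.2.1 x y] using this
  by_contra h
  apply hf.2.1
  ext t
  have h2 := h1 1
  have h3 := h1 t
  simp only [map_one, one_mul] at h2
  rw [eq_neg_of_add_eq_zero_right h2] at h3
  have h4 : (t - σ t) * f x y = 0 := by linear_combination h3
  exact (sub_eq_zero.1 ((mul_eq_zero.1 h4).resolve_right h)).symm

theorem isTransparent_hermitian (hf : IsHermitianForm σ f)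
    (hn : HasPolarRank (isotropicSubspaces f) n) (hk : k < n) :
    IsTransparent (polarGrassmannian (isotropicSubspaces f) n k)
      (polarPlucker (isotropicSubspaces f) k) :=
  hf.isPolarSystem.isTransparent_of_lt
    (fun _ hY _ hx _ hy => hf.apply_eq_zero_of_forall_apply_self (fun y hy =>
      hY y hy y (Submodule.mem_span_singleton_self y) y (Submodule.mem_span_singleton_self y))
      hx hy) hn hk

end PolarGrassmannians

/-! ### Orthogonality for nondegenerate forms -/

section Orthogonality

variable {K V : Type*} [Field K] [AddCommGroup V] [Module K V] [FiniteDimensional K V]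
  {σ : K →+* K} {f : V →ₛₗ[σ] V →ₗ[K] K} {S : Set (Submodule K V)} {n k : ℕ}

/-- Otherwise the kernel of `f a` contains the common kernel of the `f (b i)` for a basis `b` of
`X`, so `f a` is a combination of them, and nondegeneracy puts `a` in `X`. -/
theorem exists_orthogonal_of_notMem (hσ : ∀ a, σ (σ a) = a) (hf : f.SeparatingLeft)
    {X : Submodule K V} {a : V} (ha : a ∉ X) : ∃ y, (∀ x ∈ X, f x y = 0) ∧ f a y ≠ 0 := by
  by_contra! h
  let b := finBasis K X
  have h1 : f a ∈ Submodule.span K (Set.range fun i => f (b i : V)) := by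
    refine mem_span_of_iInf_ker_le_ker fun y hy => h y fun x hx => ?_
    rw [Submodule.mem_iInf] at hy
    have h2 : ((⟨x, hx⟩ : X) : V) = _ := congrArg Subtype.val (b.sum_repr ⟨x, hx⟩).symm
    rw [Submodule.coe_sum] at h2
    change x = _ at h2
    rw [h2, map_sum, LinearMap.sum_apply]
    refine Finset.sum_eq_zero fun i _ => ?_
    rw [Submodule.coe_smul, LinearMap.map_smulₛₗ, LinearMap.smul_apply,
      show f (b i : V) y = 0 from hy i, smul_zero]
  obtain ⟨c, hc⟩ := (Submodule.mem_span_range_iff_exists_fun K).1 h1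
  apply ha
  -- `f` is `σ`-semilinear in its first argument, so the coefficients are twisted; `σ` being
  -- involutory, `f` restores them.
  have h2 : a - ∑ i, σ (c i) • (b i : V) = 0 := by
    refine hf _ fun y => ?_
    rw [map_sub, map_sum, LinearMap.sub_apply, ← hc]
    simp [LinearMap.map_smulₛₗ, hσ]
  rw [sub_eq_zero.1 h2]
  exact X.sum_mem fun i _ => X.smul_mem _ (b i).2

namespace IsPolarSystem

/-- If maximal singular subspaces are self-orthogonal, then all the maximal singular subspaces
through the hyperplane `A ⊓ B` are contained in `A ⊔ B`. -/
theorem le_sup_of_inf_le (hS : IsPolarSystem f S)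
    (hmax : ∀ A ∈ S, finrank K A = n → ∀ v, (∀ x ∈ A, f x v = 0) → v ∈ A) {A B Z : Submodule K V}
    (hAS : A ∈ S) (hA : finrank K A = n) (hB : finrank K B = n) (hBS : B ∈ S)
    (hd : finrank K (A ⊓ B : Submodule K V) + 1 = n) (hZ : Z ∈ S) (hZX : A ⊓ B ≤ Z) :
    Z ≤ A ⊔ B := by
  intro z hz
  obtain ⟨b, hbB, hbA⟩ : ∃ b ∈ B, b ∉ A := by
    by_contra! h
    have : A ⊓ B = B := inf_eq_right.2 h
    rw [this] at hd
    omega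
  obtain ⟨a, haA, hab⟩ : ∃ a ∈ A, f a b ≠ 0 := by
    by_contra! h
    exact hbA (hmax A hAS hA b h)
  have haX : a ∉ A ⊓ B := fun h => hab (hS.ortho B hBS _ h.2 _ hbB)
  have hAe := sup_span_singleton_eq inf_le_left (by omega) haA haX
  -- The coefficient makes the difference orthogonal to `a`. Since `z` and `b` are both orthogonal
  -- to `A ⊓ B`, the difference is orthogonal to all of `A`.
  have key : z - (f a z / f a b) • b ∈ A := by
    refine hmax A hAS hA _ fun x hx => ?_
    rw [← hAe] at hx
    obtain ⟨x₀, hx₀, y, hy, rfl⟩ := Submodule.mem_sup.1 hx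
    obtain ⟨t, rfl⟩ := Submodule.mem_span_singleton.1 hy
    have h1 := hS.ortho Z hZ _ (hZX hx₀) _ hz
    have h2 := hS.ortho B hBS _ hx₀.2 _ hbB
    simp only [map_add, LinearMap.map_smulₛₗ, LinearMap.add_apply, LinearMap.smul_apply, map_sub,
      map_smul, smul_eq_mul, h1, h2]
    field_simp
    ring
  have := add_mem (Submodule.mem_sup_left (T := B) key)
    (Submodule.mem_sup_right (Submodule.smul_mem B (f a z / f a b) hbB))
  rwa [sub_add_cancel] at this

end IsPolarSystem

end Orthogonality

/-! ### Symplectic polar grassmannians -/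

section Symplectic

variable {K V : Type*} [Field K] [AddCommGroup V] [Module K V] [FiniteDimensional K V]
  {f : V →ₗ[K] V →ₗ[K] K} {n k : ℕ}

namespace IsSymplecticForm

omit [FiniteDimensional K V] in
theorem span_singleton_mem (hf : IsSymplecticForm f) (v : V) :
    K ∙ v ∈ isotropicSubspaces f := by
  intro x hx y hy
  obtain ⟨s, rfl⟩ := Submodule.mem_span_singleton.1 hx
  obtain ⟨t, rfl⟩ := Submodule.mem_span_singleton.1 hy
  simp [hf.1.self_eq_zero]

omit [FiniteDimensional K V] in
theorem sup_span_singleton_mem (hf : IsSymplecticForm f) {X : Submodule K V}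
    (hX : X ∈ isotropicSubspaces f) {v : V} (hv : ∀ x ∈ X, f x v = 0) :
    X ⊔ K ∙ v ∈ isotropicSubspaces f :=
  hf.isPolarSystem.sup_span_singleton_mem hX (hf.span_singleton_mem v)
    (Submodule.mem_span_singleton_self v) hv

/-- Every vector is isotropic, so adjoining to `A` an orthogonal vector outside it would exceed the
rank. -/
theorem mem_of_orthogonal (hf : IsSymplecticForm f) (hn : HasPolarRank (isotropicSubspaces f) n)
    (A) (hAS : A ∈ isotropicSubspaces f) (hA : finrank K A = n) (v : V)
    (hv : ∀ x ∈ A, f x v = 0) : v ∈ A := by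
  by_contra hvA
  have h1 := hn.2 _ (hf.sup_span_singleton_mem hAS hv)
  rw [Submodule.finrank_sup_span_singleton hvA] at h1
  omega

theorem exists_orthogonal (hf : IsSymplecticForm f) {X : Submodule K V} {a : V} (ha : a ∉ X) :
    ∃ y, (∀ x ∈ X, f x y = 0) ∧ f a y ≠ 0 :=
  exists_orthogonal_of_notMem (fun _ => rfl) hf.2.1 ha

/-- All the subspaces of a line of the projective grassmannian are totally isotropic as soon as
two of them are. -/
theorem mem_of_inf_le_of_le_sup (hf : IsSymplecticForm f)
    {A B : PolarPoint (isotropicSubspaces f) k}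
    (hd : finrank K (A.1 ⊓ B.1 : Submodule K V) + 1 = k) (C : Submodule K V)
    (hC : finrank K C = k) (h1 : A.1 ⊓ B.1 ≤ C) (h2 : C ≤ A.1 ⊔ B.1) :
    C ∈ isotropicSubspaces f := by
  obtain ⟨c, hcC, hcX⟩ := SetLike.exists_of_lt
    (lt_of_le_of_ne h1 (fun h' => by rw [h'] at hd; omega))
  rw [← sup_span_singleton_eq h1 (by omega) hcC hcX]
  -- Only orthogonality of `c` to `A ⊓ B` is to be checked, since `c` is isotropic in any case.
  refine hf.sup_span_singleton_mem (hf.isPolarSystem.mono _ A.2.1 _ inf_le_left) fun x hx => ?_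
  obtain ⟨a, ha, b, hb, rfl⟩ := Submodule.mem_sup.1 (h2 hcC)
  rw [map_add, A.2.1 x hx.1 a ha, B.2.1 x hx.2 b hb, add_zero]

theorem joinPoints_subset_range (hf : IsSymplecticForm f)
    {A B : PolarPoint (isotropicSubspaces f) k}
    (hd : finrank K (A.1 ⊓ B.1 : Submodule K V) + 1 = k) :
    joinPoints (polarPlucker (isotropicSubspaces f) k A)
      (polarPlucker (isotropicSubspaces f) k B) ⊆
        Set.range (polarPlucker (isotropicSubspaces f) k) :=
  (joinPoints_toImageSpan_subset_range _ _ _).2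
    (IsPolarSystem.joinPoints_subset_of_forall hd (hf.mem_of_inf_le_of_le_sup hd))

/-- Take `b` orthogonal to `X` but not to some `a ∈ A` outside `X`, and `B = X ⊔ K ∙ b`. For `k < n`
this gives non-collinear points meeting in a hyperplane; for `k = n` it gives a second point on a
line. -/
theorem exists_pair_sup_notMem (hf : IsSymplecticForm f) {X A : Submodule K V}
    (hXA : X ≤ A) (hA : A ∈ isotropicSubspaces f) (hX : finrank K X + 1 = k)
    (hAk : finrank K A = k) :
    ∃ B ∈ isotropicSubspaces f, finrank K B = k ∧ A ⊓ B = X ∧ A ⊔ B ∉ isotropicSubspaces f := by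
  obtain ⟨a, haA, haX⟩ := SetLike.exists_of_lt
    (lt_of_le_of_ne hXA (fun h' => by rw [h'] at hX; omega))
  obtain ⟨b, hb, hab⟩ := hf.exists_orthogonal haX
  have hbB : b ∈ X ⊔ K ∙ b := Submodule.mem_sup_right (Submodule.mem_span_singleton_self b)
  have hbA : b ∉ A := fun h => hab (hA a haA b h)
  have hB : finrank K (X ⊔ K ∙ b : Submodule K V) = k := by
    rw [Submodule.finrank_sup_span_singleton fun h => hbA (hXA h), hX]
  refine ⟨X ⊔ K ∙ b, hf.sup_span_singleton_mem (hf.isPolarSystem.mono A hA _ hXA) hb, hB, ?_, ?_⟩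
  · exact inf_eq_of_finrank hAk hB hXA le_sup_left hX fun h => hbA (h ▸ hbB)
  · exact fun h => hab (h a (Submodule.mem_sup_left haA) b (Submodule.mem_sup_right hbB))

/-- There are points at distance two meeting in a hyperplane. -/
theorem exists_one_lt_dist (hf : IsSymplecticForm f) (hn : HasPolarRank (isotropicSubspaces f) n)
    (hk : 1 ≤ k) (hkn : k < n) : ∃ A B : PolarPoint (isotropicSubspaces f) k,
      finrank K (A.1 ⊓ B.1 : Submodule K V) + 1 = k ∧
      1 < (polarGrassmannian (isotropicSubspaces f) n k).collinearityGraph.dist A B := by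
  obtain ⟨⟨A, hA, hAk⟩⟩ := hf.isPolarSystem.nonempty_polarPoint hn hkn.le
  obtain ⟨X, -, hXA, hX⟩ := exists_between_finrank_eq (bot_le : ⊥ ≤ A) (j := k - 1) (by simp)
    (by omega)
  obtain ⟨B, hB, hBk, hinf, hsup⟩ :=
    hf.exists_pair_sup_notMem hXA hA (by omega) hAk
  have hd : finrank K (A ⊓ B : Submodule K V) + 1 = k := by rw [hinf]; omega
  refine ⟨⟨A, hA, hAk⟩, ⟨B, hB, hBk⟩, hd, ?_⟩
  refine (hf.isPolarSystem.isAdmissible_of_lt hn hkn).connected.one_lt_dist_of_ne_of_not_adj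
    ?_ ?_
  · exact fun h => ne_of_finrank_inf hAk hd (congrArg Subtype.val h)
  · exact fun h => hsup ((IsPolarSystem.finrank_inf_of_adj h).2 hkn)

/-- There are points at distance two which do not meet in a hyperplane. -/
theorem exists_edist_le_two (hf : IsSymplecticForm f) (hn : HasPolarRank (isotropicSubspaces f) n)
    (hk : 1 < k) (hkn : k < n) : ∃ A B : PolarPoint (isotropicSubspaces f) k, A ≠ B ∧
      finrank K (A.1 ⊓ B.1 : Submodule K V) + 1 ≠ k ∧
      (polarGrassmannian (isotropicSubspaces f) n k).collinearityGraph.edist A B ≤ 2 := by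
  have hS := hf.isPolarSystem
  -- `D` will be the common neighbour. The extra dimension of `M` provides `a` outside `D` and
  -- orthogonal to it; then `b` is orthogonal to `D` but not to `a`.
  obtain ⟨⟨M, hM, hMk⟩⟩ := hS.nonempty_polarPoint hn (k := k + 1) (by omega)
  obtain ⟨D, -, hDM, hD⟩ := exists_between_finrank_eq (bot_le : ⊥ ≤ M) (j := k) (by simp)
    (by omega)
  have hDS := hS.mono M hM D hDM
  obtain ⟨a, haM, haD⟩ := SetLike.exists_of_lt
    (lt_of_le_of_ne hDM (fun h' => by rw [h'] at hD; omega))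
  obtain ⟨b, hb, hab⟩ := hf.exists_orthogonal haD
  have hDa : ∀ x ∈ D, f a x = 0 := fun x hx => hM a haM x (hDM hx)
  have hbD : b ∉ D := fun h => hab (hDa b h)
  -- With two hyperplanes `X₁`, `X₂` of `D` meeting in `X`, the points `X₁ ⊔ K ∙ a` and `X₂ ⊔ K ∙ b`
  -- are both collinear with `D` but meet only in dimension `k - 2`. This is where `1 < k` is
  -- needed.
  obtain ⟨X, -, hXD, hX⟩ := exists_between_finrank_eq (bot_le : ⊥ ≤ D) (j := k - 2) (by simp)
    (by omega)
  obtain ⟨X₁, X₂, h₁, h₂, -, hinf, hsup⟩ := exists_pair_between hXD (k := k - 1) (by omega)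
    (by omega)
  have hX₁ : X₁ ≤ D := hsup ▸ le_sup_left
  have hX₂ : X₂ ≤ D := hsup ▸ le_sup_right
  have haA : a ∈ X₁ ⊔ K ∙ a := Submodule.mem_sup_right (Submodule.mem_span_singleton_self a)
  have hbB : b ∈ X₂ ⊔ K ∙ b := Submodule.mem_sup_right (Submodule.mem_span_singleton_self b)
  have hDaS : D ⊔ K ∙ a ∈ isotropicSubspaces f :=
    hf.sup_span_singleton_mem hDS fun x hx => hM x (hDM hx) a haM
  have hDbS : D ⊔ K ∙ b ∈ isotropicSubspaces f := hf.sup_span_singleton_mem hDS hb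
  have hAS := hS.mono _ hDaS (X₁ ⊔ K ∙ a) (sup_le_sup_right hX₁ _)
  have hBS := hS.mono _ hDbS (X₂ ⊔ K ∙ b) (sup_le_sup_right hX₂ _)
  have hA : finrank K (X₁ ⊔ K ∙ a : Submodule K V) = k := by
    rw [Submodule.finrank_sup_span_singleton fun h => haD (hX₁ h)]
    omega
  have hB : finrank K (X₂ ⊔ K ∙ b : Submodule K V) = k := by
    rw [Submodule.finrank_sup_span_singleton fun h => hbD (hX₂ h)]
    omega
  have hAD : finrank K ((X₁ ⊔ K ∙ a) ⊓ D : Submodule K V) + 1 = k := by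
    rw [inf_eq_of_finrank hA hD le_sup_left hX₁ (by omega) fun h => haD (h ▸ haA)]
    omega
  have hBD : finrank K ((X₂ ⊔ K ∙ b) ⊓ D : Submodule K V) + 1 = k := by
    rw [inf_eq_of_finrank hB hD le_sup_left hX₂ (by omega) fun h => hbD (h ▸ hbB)]
    omega
  refine ⟨⟨_, hAS, hA⟩, ⟨_, hBS, hB⟩, fun h => hab ?_, fun h => ?_, ?_⟩
  · exact hAS a haA b ((congrArg Subtype.val h).ge hbB)
  -- Write `v = x₁ + α a = x₂ + β b`. Pairing with `a` kills `β`, pairing with `b` kills `α`, so `v`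
  -- lies in `X₁ ⊓ X₂`.
  · have hle : (X₁ ⊔ K ∙ a) ⊓ (X₂ ⊔ K ∙ b) ≤ X := by
      rintro v ⟨hv₁, hv₂⟩
      obtain ⟨x₁, hx₁, y, hy, hv₁'⟩ := Submodule.mem_sup.1 hv₁
      obtain ⟨α, rfl⟩ := Submodule.mem_span_singleton.1 hy
      obtain ⟨x₂, hx₂, y, hy, hv₂'⟩ := Submodule.mem_sup.1 hv₂
      obtain ⟨β, rfl⟩ := Submodule.mem_span_singleton.1 hy
      have e₁ := hAS a haA v hv₁
      have e₂ := hBS v hv₂ b hbB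
      rw [← hv₂', map_add, hDa x₂ (hX₂ hx₂), map_smul, zero_add, smul_eq_mul,
        mul_eq_zero, or_iff_left hab] at e₁
      rw [← hv₁', map_add, LinearMap.add_apply, hb x₁ (hX₁ hx₁), map_smul, LinearMap.smul_apply,
        zero_add, smul_eq_mul, mul_eq_zero, or_iff_left hab] at e₂
      rw [e₁, zero_smul, add_zero] at hv₂'
      rw [e₂, zero_smul, add_zero] at hv₁'
      rw [← hinf]
      exact ⟨hv₁' ▸ hx₁, hv₂' ▸ hx₂⟩
    have := Submodule.finrank_mono hle
    simp only at h
    omega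
  · have e₁ := hS.adj_of_sup_mem hkn (A := ⟨_, hAS, hA⟩) (B := ⟨D, hDS, hD⟩) hAD
      (hS.mono _ hDaS _ (sup_le (sup_le_sup_right hX₁ _) le_sup_left))
    have e₂ := hS.adj_of_sup_mem hkn (A := ⟨_, hBS, hB⟩) (B := ⟨D, hDS, hD⟩) hBD
      (hS.mono _ hDbS _ (sup_le (sup_le_sup_right hX₂ _) le_sup_left))
    refine (SimpleGraph.edist_le (.cons e₁ (.cons e₂.symm .nil))).trans ?_
    norm_num

theorem isCompletelyOpaque (hf : IsSymplecticForm f) (hn : HasPolarRank (isotropicSubspaces f) n)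
    (h2 : 2 ≤ n) : IsCompletelyOpaque (polarGrassmannian (isotropicSubspaces f) n 1)
      (polarPlucker (isotropicSubspaces f) 1) := by
  refine ⟨hf.isPolarSystem.isProjectiveEmbedding_of_lt hn (by omega), ?_, ?_⟩
  · obtain ⟨A, B, -, h⟩ := hf.exists_one_lt_dist hn le_rfl (by omega)
    exact h.trans_le (SimpleGraph.dist_le_diam
      (hf.isPolarSystem.isAdmissible_of_lt hn (by omega)).finiteDiam)
  · rw [Set.eq_univ_iff_forall]
    intro p
    obtain ⟨w, hw, hp⟩ : ∃ w hw, imageSpanInclusion _ p = .mk K w hw :=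
      ⟨_, _, (Projectivization.mk_rep _).symm⟩
    -- Under `⋀¹ V ≅ V` every vector is decomposable, and every vector is isotropic.
    set v := exteriorPower.oneEquiv K V w with hv
    have hwv : w = exteriorPower.ιMulti K 1 fun _ => v := by
      apply (exteriorPower.oneEquiv K V).injective
      rw [exteriorPower.oneEquiv_ιMulti, hv]
    have hv0 : v ≠ 0 := by
      rw [hv]
      simpa using hw
    have hLI : LinearIndependent K fun _ : Fin 1 => v := LinearIndependent.of_subsingleton 0 hv0
    refine ⟨⟨K ∙ v, hf.span_singleton_mem v, finrank_span_singleton hv0⟩, ?_⟩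
    apply imageSpanInclusion_injective
    rw [polarPlucker, imageSpanInclusion_toImageSpan, hp, polarPluckerMap,
      pluckerPoint_eq _ _ (fun _ => v) hLI fun _ => Submodule.mem_span_singleton_self v]
    congr 1
    exact hwv.symm

/-- The join of distinct points lies in the image precisely when they meet in a hyperplane.
Collinear points do, points that do are at distance at most two, and at distance two both behaviours
occur: the pair from `exists_edist_le_two` bounds the lower degree, that from `exists_one_lt_dist`
the upper one. -/
theorem isOpaque (hf : IsSymplecticForm f) (hn : HasPolarRank (isotropicSubspaces f) n)
    (hk : 1 < k) (hkn : k < n) : IsOpaque (polarGrassmannian (isotropicSubspaces f) n k)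
      (polarPlucker (isotropicSubspaces f) k) 0 1 := by
  have hadm := hf.isPolarSystem.isAdmissible_of_lt hn hkn
  obtain ⟨A, B, hd, hAB⟩ := hf.exists_one_lt_dist hn hk.le hkn
  have hdiam := SimpleGraph.dist_le_diam hadm.finiteDiam (u := A) (v := B)
  have hjoin : ∀ x y : PolarPoint (isotropicSubspaces f) k, x ≠ y →
      joinPoints (polarPlucker (isotropicSubspaces f) k x)
        (polarPlucker (isotropicSubspaces f) k y) ⊆
          Set.range (polarPlucker (isotropicSubspaces f) k) →
      finrank K (x.1 ⊓ y.1 : Submodule K V) + 1 = k := fun x y hxy h =>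
    (IsPolarSystem.finrank_inf_of_joinPoints_subset hxy
      ((joinPoints_toImageSpan_subset_range _ _ _).1 h)).1
  have htwo : ∀ x y : PolarPoint (isotropicSubspaces f) k,
      (polarGrassmannian (isotropicSubspaces f) n k).collinearityGraph.edist x y ≤ 2 →
      (polarGrassmannian (isotropicSubspaces f) n k).collinearityGraph.dist x y ≤ 2 := by
    intro x y h
    rw [← (hadm.connected x y).coe_dist_eq_edist] at h
    exact_mod_cast h
  refine ⟨hf.isPolarSystem.isProjectiveEmbedding_of_lt hn hkn,
    ⟨⟨le_rfl, by omega, fun x y h => ?_⟩, fun h hh => ?_⟩,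
    ⟨⟨by omega, by omega, fun x y h h' => ?_⟩, fun h hh => ?_⟩⟩
  · rcases Nat.le_one_iff_eq_zero_or_eq_one.1 h with h | h
    · rw [hadm.connected.dist_eq_zero_iff] at h
      rw [h, joinPoints_self]
      exact Set.singleton_subset_iff.2 ⟨y, rfl⟩
    · exact hf.joinPoints_subset_range
        (IsPolarSystem.finrank_inf_of_adj (SimpleGraph.dist_eq_one_iff_adj.1 h)).1
  · by_contra hlt
    obtain ⟨x, y, hxy, hd', h2⟩ := hf.exists_edist_le_two hn hk hkn
    have := htwo x y h2
    exact hd' (hjoin x y hxy (hh.2.2 x y (by omega)))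
  · have hxy : x ≠ y := by
      rintro rfl
      simp at h
    have := htwo x y (hf.isPolarSystem.edist_le_two hn hkn (hjoin x y hxy h'))
    omega
  · by_contra hlt
    have h1 := hh.1
    exact hh.2.2 A B (by omega) (hf.joinPoints_subset_range hd)

/-- Self-orthogonality of maximal subspaces confines all those through `A ⊓ B` to `A ⊔ B`, while the
pencil of `A` and `B` is wholly isotropic; so lines of the geometry are full pencils. -/
theorem isTransparent_dual (hf : IsSymplecticForm f)
    (hn : HasPolarRank (isotropicSubspaces f) n) :
    IsTransparent (polarGrassmannian (isotropicSubspaces f) n n)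
      (polarPlucker (isotropicSubspaces f) n) := by
  have hS := hf.isPolarSystem
  refine (IsProjectiveEmbedding.of_joinPoints (hS.isAdmissible_dual hn)
    (toImageSpan_injective _ IsPolarSystem.polarPluckerMap_injective)
    (iSup_toImageSpan _) ?_).isTransparent fun A B hne h => ?_
  · rintro l (⟨h, -⟩ | ⟨-, X, hXS, hX, rfl⟩)
    · omega
    obtain ⟨A, hAS, hXA, hA⟩ := hS.exists_ge_finrank_eq hn hXS
    obtain ⟨B, hBS, hB, rfl, -⟩ := hf.exists_pair_sup_notMem hXA hAS hX hA
    refine ⟨⟨A, hAS, hA⟩, ⟨B, hBS, hB⟩,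
      fun h => ne_of_finrank_inf hA hX (congrArg Subtype.val h),
      (image_toImageSpan_eq_joinPoints _ _ _ _).2 ?_⟩
    rw [polarPluckerMap, polarPluckerMap, joinPoints_pluckerPoint hX]
    ext r
    constructor
    · rintro ⟨C, hC, rfl⟩
      exact ⟨C.1, C.2.2, hC, hS.le_sup_of_inf_le (hf.mem_of_orthogonal hn) hAS hA hB hBS hX
        C.2.1 hC, rfl⟩
    · rintro ⟨C, hC, h1, h2, rfl⟩
      exact ⟨⟨C, hf.mem_of_inf_le_of_le_sup (A := ⟨A, hAS, hA⟩) (B := ⟨B, hBS, hB⟩) hX C hC h1 h2,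
        hC⟩, h1, rfl⟩
  · exact (hS.adj_of_finrank_inf (IsPolarSystem.finrank_inf_of_joinPoints_subset hne
      ((joinPoints_toImageSpan_subset_range _ _ _).1 h)).1).2

end IsSymplecticForm

end Symplectic

/-! ### Hyperbolic systems for hermitian forms, and the exchange argument -/

section HermitianForms

variable {K V : Type*} [Field K] [AddCommGroup V] [Module K V]
  {σ : K →+* K} {f : V →ₛₗ[σ] V →ₗ[K] K} {n : ℕ}

namespace IsHermitianForm

/-- The trace `t + σ t` is linear over the fixed field, hence onto it unless zero. Were it zero, `t
= 1` would give `1 + 1 = 0`, and then `σ t = -t = t`. It serves to make vectors isotropic in every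
characteristic. -/
theorem exists_add_apply_eq (hf : IsHermitianForm σ f) {c : K} (hc : σ c = c) :
    ∃ t, t + σ t = c := by
  obtain ⟨t, ht⟩ : ∃ t, t + σ t ≠ 0 := by
    by_contra! h
    apply hf.2.1
    ext t
    have h1 := h 1
    have h2 := h t
    rw [map_one] at h1
    simp only [RingHom.id_apply]
    linear_combination h2 - t * h1
  refine ⟨c / (t + σ t) * t, ?_⟩
  rw [map_mul, map_div₀, hc, map_add, hf.1, add_comm (σ t) t, ← mul_add, div_mul_cancel₀ _ ht]

/-- Such an `s` is the value given to `f a b` when representatives of adjacent maximal subspaces are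
scaled. -/
theorem exists_skew (hf : IsHermitianForm σ f) : ∃ s, s ≠ 0 ∧ σ s = -s := by
  obtain ⟨t, ht⟩ : ∃ t, t - σ t ≠ 0 := by
    by_contra! h
    exact hf.2.1 (RingHom.ext fun t => (sub_eq_zero.1 (h t)).symm)
  exact ⟨t - σ t, ht, by rw [map_sub, hf.1, neg_sub]⟩

theorem apply_eq_zero_comm (hf : IsHermitianForm σ f) {x y : V} (h : f x y = 0) : f y x = 0 :=
  hf.isPolarSystem.refl x y h

theorem exists_orthogonal [FiniteDimensional K V] (hf : IsHermitianForm σ f) {X : Submodule K V}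
    {a : V} (ha : a ∉ X) : ∃ y, (∀ x ∈ X, f x y = 0) ∧ f a y ≠ 0 :=
  exists_orthogonal_of_notMem hf.1 hf.2.2.2.1 ha

theorem exists_dual_family [FiniteDimensional K V] (hf : IsHermitianForm σ f) {ι : Type*}
    [DecidableEq ι] {x : ι → V} (hx : LinearIndependent K x) :
    ∃ y : ι → V, ∀ i j, f (x i) (y j) = if i = j then 1 else 0 := by
  have h : ∀ j, ∃ y, ∀ i, f (x i) y = if i = j then 1 else 0 := by
    intro j
    obtain ⟨y, hy, hj⟩ := hf.exists_orthogonal (linearIndependent_iff_notMem_span.1 hx j)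
    refine ⟨(f (x j) y)⁻¹ • y, fun i => ?_⟩
    rw [map_smul, smul_eq_mul]
    split_ifs with hij
    · rw [hij, inv_mul_cancel₀ hj]
    · rw [hy (x i) (Submodule.subset_span ⟨i, by simpa using hij, rfl⟩), mul_zero]
  choose y hy using h
  exact ⟨y, fun i j => hy j i⟩

/-- In dimension `2n`, totally isotropic subspaces of dimension `n` are self-orthogonal. -/
theorem mem_of_orthogonal [FiniteDimensional K V] (hf : IsHermitianForm σ f)
    (hN : finrank K V = 2 * n) (A) (hAS : A ∈ isotropicSubspaces f) (hA : finrank K A = n) (v : V)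
    (hv : ∀ x ∈ A, f x v = 0) : v ∈ A := by
  obtain ⟨x, hx, hxA⟩ := exists_linearIndependent_span_eq hA
  obtain ⟨y, hy⟩ := hf.exists_dual_family hx
  have hxm : ∀ i, x i ∈ A := fun i => hxA ▸ Submodule.subset_span ⟨i, rfl⟩
  -- The dual family makes `T` onto, so its kernel, the orthogonal of `A`, has dimension `2 * n - n
  -- = n` and equals `A`.
  let T : V →ₗ[K] Fin n → K := LinearMap.pi fun i => f (x i)
  have hT : LinearMap.range T = ⊤ := by
    rw [LinearMap.range_eq_top]
    intro c
    refine ⟨∑ j, c j • y j, funext fun i => ?_⟩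
    simp [T, hy]
  have hd := T.finrank_range_add_finrank_ker
  rw [hT, finrank_top, finrank_fin_fun] at hd
  have hle : A ≤ LinearMap.ker T := fun u hu => funext fun i => hAS _ (hxm i) _ hu
  rw [Submodule.eq_of_le_of_finrank_eq hle (by omega)]
  exact funext fun i => hv _ (hxm i)

end IsHermitianForm

/-- Two mutually dual families of pairwise orthogonal isotropic vectors. -/
structure IsHyperbolicSystem (f : V →ₛₗ[σ] V →ₗ[K] K) {ι : Type*} [DecidableEq ι] (e g : ι → V) :
    Prop where
  left : ∀ i j, f (e i) (e j) = 0
  right : ∀ i j, f (g i) (g j) = 0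
  dual : ∀ i j, f (e i) (g j) = if i = j then 1 else 0

namespace IsHermitianForm

theorem exists_hyperbolicSystem [FiniteDimensional K V] (hf : IsHermitianForm σ f) {ι : Type*}
    [Fintype ι] [LinearOrder ι] {x : ι → V} (hx : LinearIndependent K x)
    (hiso : ∀ i j, f (x i) (x j) = 0) : ∃ g, IsHyperbolicSystem f x g := by
  obtain ⟨y, hy⟩ := hf.exists_dual_family hx
  have hy' : ∀ i j, f (y i) (x j) = if j = i then 1 else 0 := fun i j => by
    rw [← hf.2.2.1, hy]
    split_ifs <;> simp
  choose t ht using fun j => hf.exists_add_apply_eq (c := -f (y j) (y j))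
    (by rw [map_neg, hf.2.2.1])
  -- The dual family is corrected by vectors of the isotropic family. Coefficients on one side of
  -- the diagonal cancel each product of distinct members once; on the diagonal the trace does it.
  let c : ι → ι → K := fun k j => if j < k then -f (y j) (y k) else if j = k then t j else 0
  refine ⟨fun j => y j + ∑ k, c j k • x k, hiso, fun j k => ?_, fun i j => ?_⟩
  · have h1 : f (y j + ∑ k, c j k • x k) (y k + ∑ l, c k l • x l) =
        f (y j) (y k) + c k j + σ (c j k) := by
      simp only [map_add, LinearMap.add_apply, map_sum, LinearMap.sum_apply, map_smul,
        LinearMap.map_smulₛₗ, LinearMap.smul_apply, smul_eq_mul, hy, hy', hiso]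
      simp
      ring
    rw [h1]
    rcases lt_trichotomy j k with h | rfl | h
    · simp [c, h, h.not_gt, h.ne']
    · simp only [c, lt_irrefl, if_false, if_true]
      linear_combination ht j
    · simp [c, h, h.not_gt, h.ne', hf.2.2.1]
  · simp [hy, hiso]

end IsHermitianForm

namespace IsHyperbolicSystem

theorem linearIndependent (hf : IsHermitianForm σ f) {ι : Type*} [Fintype ι] [DecidableEq ι]
    {e g : ι → V} (h : IsHyperbolicSystem f e g) : LinearIndependent K (Sum.elim e g) := by
  rw [Fintype.linearIndependent_iff]
  intro c hc
  have hdual : ∀ i j, f (g i) (e j) = if j = i then 1 else 0 := fun i j => by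
    rw [← hf.2.2.1, h.dual]
    split_ifs <;> simp
  rw [Fintype.sum_sum_type] at hc
  simp only [Sum.elim_inl, Sum.elim_inr] at hc
  rintro (i | i)
  · have := congrArg (f (g i)) hc
    simpa [h.right, hdual] using this
  · have := congrArg (f (e i)) hc
    simpa [h.left, h.dual] using this

/-- The two changes compensate: `f (e i + a e j) (g j - σ a g i) = -σ a + σ a = 0`. The free
parameter `a` drives the exchange argument. -/
theorem update {e g : Fin n → V}
    (h : IsHyperbolicSystem f e g) {i j : Fin n} (hij : i ≠ j) (a : K) :
    IsHyperbolicSystem f (Function.update e i (e i + a • e j))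
      (Function.update g j (g j - σ a • g i)) where
  left k l := by
    simp only [Function.update_apply]
    split_ifs <;> simp [h.left]
  right k l := by
    simp only [Function.update_apply]
    split_ifs <;> simp [h.right]
  dual k l := by
    rcases eq_or_ne k i with rfl | hk <;> rcases eq_or_ne l j with rfl | hl
    · simp [h.dual, hij, hij.symm]
    · simp [h.dual, hl, hl.symm]
    · rcases eq_or_ne k l with rfl | hkl
      · simp [h.dual, hk]
      · simp [h.dual, hk, hkl]
    · simp [h.dual, hk, hl]

end IsHyperbolicSystem

theorem injective_update_of_forall_ne {α β : Type*} [DecidableEq α] {q : α → β}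
    (hq : Function.Injective q) (t : α) {b : β} (hb : ∀ r, q r ≠ b) :
    Function.Injective (Function.update q t b) := by
  intro r s hrs
  rcases eq_or_ne r t with rfl | hr <;> rcases eq_or_ne s r with rfl | hs
  · rfl
  · rw [Function.update_self, Function.update_of_ne hs] at hrs
    exact absurd hrs.symm (hb s)
  · rfl
  · rcases eq_or_ne s t with rfl | hst
    · rw [Function.update_self, Function.update_of_ne hr] at hrs
      exact absurd hrs (hb r)
    · rw [Function.update_of_ne hr, Function.update_of_ne hst] at hrs
      exact hq hrs

open Classical in
/-- The positions of those members of a list of indices of a hyperbolic system whose partner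
belongs to the list, too. -/
noncomputable def fullPairs {ι κ : Type*} [Fintype κ] (q : κ → ι ⊕ ι) : Finset κ :=
  {t | ∃ i s, q t = Sum.inr i ∧ q s = Sum.inl i}

theorem mem_fullPairs {ι κ : Type*} [Fintype κ] {q : κ → ι ⊕ ι} {t : κ} :
    t ∈ fullPairs q ↔ ∃ i s, q t = Sum.inr i ∧ q s = Sum.inl i := by
  simp [fullPairs]

/-- A selection without a full pair `e i`, `g i` is totally isotropic. If it contains such a pair,
some index `j` is not used at all. Put `e i + a e j` and `g j - σ a g i` in place of the pair and
expand: by induction the whole and two of the four terms vanish, leaving `a * φ(… e j … g j …) = σ a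
* φ(… e i … g i …)` for every `a`. Comparison with `a = 1` forces both values to be zero, since `σ`
is not the identity. -/
theorem apply_hyperbolicSystem_eq_zero (hf : IsHermitianForm σ f) {φ : V [⋀^Fin n]→ₗ[K] K}
    (hφ : ∀ v : Fin n → V, (∀ i j, f (v i) (v j) = 0) → φ v = 0) {e g : Fin n → V}
    (h : IsHyperbolicSystem f e g) (q : Fin n → Fin n ⊕ Fin n) (hq : Function.Injective q) :
    φ (Sum.elim e g ∘ q) = 0 := by
  induction hp : (fullPairs q).card using Nat.strong_induction_on generalizing e g q with
  | _ p ih =>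
    by_cases hpair : (fullPairs q).Nonempty
    · obtain ⟨t, ht⟩ := hpair
      obtain ⟨i, s, hqt, hqs⟩ := mem_fullPairs.1 ht
      have hst : s ≠ t := by
        rintro rfl
        simp [hqs] at hqt
      -- If all `n` indices occurred among the `n` positions, each would occur once, yet `i` occurs
      -- at both `s` and `t`.
      obtain ⟨j, hj⟩ : ∃ j, ∀ r, q r ≠ Sum.inl j ∧ q r ≠ Sum.inr j := by
        by_contra! hall
        have hsurj : Function.Surjective (Sum.elim id id ∘ q) := by
          intro j
          obtain ⟨r, hr⟩ := hall j
          refine ⟨r, ?_⟩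
          by_cases h1 : q r = Sum.inl j
          · simp [h1]
          · simp [hr h1]
        exact hst (Finite.injective_iff_surjective.2 hsurj (by simp [hqs, hqt]))
      have hij : i ≠ j := fun h' => (hj s).1 (h' ▸ hqs)
      have hlt₁ : (fullPairs (Function.update q t (Sum.inr j))).card < p := by
        rw [← hp]
        refine Finset.card_lt_card ((Finset.ssubset_iff_of_subset fun t' ht' => ?_).2 ⟨t, ht, ?_⟩)
        all_goals simp only [mem_fullPairs] at *
        · obtain ⟨i', s', h1, h2⟩ := ht'
          have hs' : s' ≠ t := by
            rintro rfl
            simp at h2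
          rw [Function.update_of_ne hs'] at h2
          rcases eq_or_ne t' t with rfl | ht'
          · simp only [Function.update_self, Sum.inr.injEq] at h1
            exact absurd (h1 ▸ h2) (hj s').1
          · rw [Function.update_of_ne ht'] at h1
            exact ⟨i', s', h1, h2⟩
        · rintro ⟨i', s', h1, h2⟩
          simp only [Function.update_self, Sum.inr.injEq] at h1
          have hs' : s' ≠ t := by
            rintro rfl
            simp at h2
          rw [Function.update_of_ne hs'] at h2
          exact (hj s').1 (h1 ▸ h2)
      have hlt₂ : (fullPairs (Function.update q s (Sum.inl j))).card < p := by
        rw [← hp]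
        refine Finset.card_lt_card ((Finset.ssubset_iff_of_subset fun t' ht' => ?_).2 ⟨t, ht, ?_⟩)
        all_goals simp only [mem_fullPairs] at *
        · obtain ⟨i', s', h1, h2⟩ := ht'
          have ht' : t' ≠ s := by
            rintro rfl
            simp at h1
          rw [Function.update_of_ne ht'] at h1
          rcases eq_or_ne s' s with rfl | hs'
          · simp only [Function.update_self, Sum.inl.injEq] at h2
            exact absurd (h2 ▸ h1) (hj t').2
          · rw [Function.update_of_ne hs'] at h2
            exact ⟨i', s', h1, h2⟩
        · rintro ⟨i', s', h1, h2⟩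
          rw [Function.update_of_ne hst.symm, hqt, Sum.inr.injEq] at h1
          rcases eq_or_ne s' s with rfl | hs'
          · simp only [Function.update_self, Sum.inl.injEq] at h2
            exact hij (h1.trans h2.symm)
          · rw [Function.update_of_ne hs', ← h1, ← hqs] at h2
            exact hs' (hq h2)
      set v := Sum.elim e g ∘ q with hv
      have hupd : ∀ x y, Function.update (Function.update v s x) t y =
          fun r => if r = t then y else if r = s then x else v r := fun x y => by
        ext r
        simp [Function.update_apply]
      have z₁ := ih _ hlt₁ h _ (injective_update_of_forall_ne hq t fun r => (hj r).2) rfl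
      have z₂ := ih _ hlt₂ h _ (injective_update_of_forall_ne hq s fun r => (hj r).1) rfl
      have e₁ : Sum.elim e g ∘ Function.update q t (Sum.inr j) =
          Function.update (Function.update v s (e i)) t (g j) := by
        rw [hupd]
        ext r
        by_cases hrt : r = t
        · simp [hrt]
        · by_cases hrs : r = s
          · simp [hrs, hst, hqs]
          · simp [hrt, hrs, hv]
      have e₂ : Sum.elim e g ∘ Function.update q s (Sum.inl j) =
          Function.update (Function.update v s (e j)) t (g i) := by
        rw [hupd]
        ext r
        by_cases hrt : r = t
        · simp [hrt, hst.symm, hqt]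
        · by_cases hrs : r = s
          · simp [hrs, hst]
          · simp [hrt, hrs, hv]
      have e₃ : v = Function.update (Function.update v s (e i)) t (g i) := by
        rw [hupd]
        ext r
        by_cases hrt : r = t
        · simp [hrt, hv, hqt]
        · by_cases hrs : r = s
          · simp [hrs, hst, hv, hqs]
          · simp [hrt, hrs]
      have key : ∀ a : K, a * φ (Function.update (Function.update v s (e j)) t (g j)) =
          σ a * φ v := by
        intro a
        -- `fullPairs` depends only on the selection and not on the vectors, so the same decrease
        -- serves for the modified system.
        have z := ih _ hlt₁ (h.update hij a) _
          (injective_update_of_forall_ne hq t fun r => (hj r).2) rfl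
        have e₄ : Sum.elim (Function.update e i (e i + a • e j))
            (Function.update g j (g j - σ a • g i)) ∘ Function.update q t (Sum.inr j) =
            Function.update (Function.update v s (e i + a • e j)) t (g j - σ a • g i) := by
          rw [hupd]
          ext r
          by_cases hrt : r = t
          · simp only [Function.comp_apply, hrt, Function.update_self, Sum.elim_inr, if_true]
          · by_cases hrs : r = s
            · simp only [Function.comp_apply, hrs, Function.update_of_ne hst, hqs, Sum.elim_inl,
                Function.update_self, if_neg hst, if_true]
            · have h1 : q r ≠ Sum.inl i := fun h' => hrs (hq (h'.trans hqs.symm))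
              have h2 := (hj r).2
              simp only [Function.comp_apply, Function.update_of_ne hrt, if_neg hrt, if_neg hrs,
                hv]
              rcases hqr : q r with k | k
              · rw [Sum.elim_inl, Sum.elim_inl, Function.update_of_ne]
                rintro rfl
                exact h1 hqr
              · rw [Sum.elim_inr, Sum.elim_inr, Function.update_of_ne]
                rintro rfl
                exact h2 hqr
        rw [e₁] at z₁
        rw [e₂] at z₂
        rw [e₄, φ.map_update_sub, φ.map_update_smul, Function.update_comm hst,
          Function.update_comm hst, φ.map_update_add, φ.map_update_add, φ.map_update_smul,
          φ.map_update_smul, Function.update_comm hst.symm, Function.update_comm hst.symm,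
          Function.update_comm hst.symm, Function.update_comm hst.symm, z₁, z₂, ← e₃] at z
        simp only [smul_eq_mul, mul_zero, add_zero, zero_add] at z
        exact sub_eq_zero.1 z
      by_contra hne
      apply hf.2.1
      ext a
      have h1 := key 1
      rw [map_one, one_mul, one_mul] at h1
      have h2 := key a
      rw [h1] at h2
      exact (mul_right_cancel₀ hne h2).symm
    · refine hφ _ fun s t => ?_
      rw [Finset.not_nonempty_iff_eq_empty, Finset.eq_empty_iff_forall_notMem] at hpair
      have hne : ∀ s t i j, q s = Sum.inl i → q t = Sum.inr j → i ≠ j := by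
        rintro s t i _ h1 h2 rfl
        exact hpair t (mem_fullPairs.2 ⟨i, s, h2, h1⟩)
      rcases hs : q s with i | i <;> rcases ht : q t with j | j
      · simp [hs, ht, h.left]
      · simp [hs, ht, h.dual, hne s t i j hs ht]
      · simp only [Function.comp_apply, hs, ht, Sum.elim_inl, Sum.elim_inr]
        apply hf.apply_eq_zero_comm
        simp [h.dual, hne t s j i ht hs]
      · simp [hs, ht, h.right]

end HermitianForms

/-! ### Construction of the Baer subgeometry -/

section BaerSubgeometry

variable {K V : Type*} [Field K] [AddCommGroup V] [Module K V]
  {σ : K →+* K} {f : V →ₛₗ[σ] V →ₗ[K] K} {n : ℕ}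

/-- The alternating map obtained by fixing the right half of the arguments. -/
def AlternatingMap.fixRight {ι κ : Type*} [DecidableEq κ]
    (vol : V [⋀^ι ⊕ κ]→ₗ[K] K) (y : κ → V) : V [⋀^ι]→ₗ[K] K where
  toFun x := vol (Sum.elim x y)
  map_update_add' x i a b := by
    simp only [← Sum.update_elim_inl]
    exact vol.map_update_add _ _ _ _
  map_update_smul' x i c a := by
    simp only [← Sum.update_elim_inl]
    exact vol.map_update_smul _ _ _ _
  map_eq_zero_of_eq' x i j hij hne :=
    vol.map_eq_zero_of_eq _ (i := Sum.inl i) (j := Sum.inl j) hij (by simpa using hne)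

/-- The linear form `w ↦ vol (w ∧ y₁ ∧ ⋯ ∧ y_n)`. -/
noncomputable def volPairing (vol : V [⋀^Fin n ⊕ Fin n]→ₗ[K] K) (y : Fin n → V) :
    ⋀[K]^n V →ₗ[K] K :=
  exteriorPower.alternatingMapLinearEquiv (vol.fixRight y)

theorem volPairing_ιMulti (vol : V [⋀^Fin n ⊕ Fin n]→ₗ[K] K) (x y : Fin n → V) :
    volPairing vol y (exteriorPower.ιMulti K n x) = vol (Sum.elim x y) :=
  exteriorPower.alternatingMapLinearEquiv_apply_ιMulti _ _

/-- The linear form `w ↦ f (y₁ ∧ ⋯ ∧ y_n, w)`, for the natural extension of `f` to `⋀ⁿ V`. -/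
noncomputable def formPairing (f : V →ₛₗ[σ] V →ₗ[K] K) (y : Fin n → V) : ⋀[K]^n V →ₗ[K] K :=
  exteriorPower.pairingDual K V n (exteriorPower.ιMulti K n fun j => f (y j))

theorem formPairing_ιMulti (f : V →ₛₗ[σ] V →ₗ[K] K) (x y : Fin n → V) :
    formPairing f y (exteriorPower.ιMulti K n x) = (Matrix.of fun i j => f (y j) (x i)).det :=
  exteriorPower.pairingDual_ιMulti_ιMulti _ _

/-- The vectors on which the semilinear form given by `f` is `μ` times the one given by `vol`;
they constitute a vector space over the field fixed by `σ`. -/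
def IsBaerVector (f : V →ₛₗ[σ] V →ₗ[K] K) (vol : V [⋀^Fin n ⊕ Fin n]→ₗ[K] K) (μ : K)
    (w : ⋀[K]^n V) : Prop :=
  ∀ y, σ (formPairing f y w) = μ * volPairing vol y w

namespace IsHermitianForm

theorem map_formPairing_ιMulti (hf : IsHermitianForm σ f) (x y : Fin n → V) :
    σ (formPairing f y (exteriorPower.ιMulti K n x)) =
      (Matrix.of fun i j => f (x i) (y j)).det := by
  rw [formPairing_ιMulti, RingHom.map_det]
  congr 1
  ext i j
  exact hf.2.2.1 _ _

/-- The natural extension of `f` to `⋀ⁿ V` is non-degenerate. -/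
theorem eq_zero_of_formPairing [FiniteDimensional K V] (hf : IsHermitianForm σ f)
    {w : ⋀[K]^n V} (hw : ∀ y, formPairing f y w = 0) : w = 0 := by
  let b := finBasis K V
  obtain ⟨y, hy⟩ := hf.exists_dual_family b.linearIndependent
  -- So pairing with a subfamily of `y` gives a coordinate with respect to the induced basis of `⋀ⁿ
  -- V`.
  have hyb : ∀ j, f (y j) = b.coord j := fun j => b.ext fun i => by
    rw [← hf.2.2.1, hy, b.coord_apply, b.repr_self, Finsupp.single_apply]
    split_ifs <;> simp
  refine (b.exteriorPower n).ext_elem fun s => ?_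
  rw [map_zero, ← Basis.coord_apply, exteriorPower.basis_coord, Finsupp.zero_apply]
  have := hw fun j => y (Set.powersetCard.ofFinEmbEquiv.symm s j)
  simp only [formPairing, hyb] at this
  exact this

variable [FiniteDimensional K V]

/-- In dimension `2n`, the decomposable vectors of the maximal totally isotropic subspaces
span the exterior power. -/
theorem eq_zero_of_forall_isotropic (hf : IsHermitianForm σ f)
    (hn : HasPolarRank (isotropicSubspaces f) n) (hN : finrank K V = 2 * n)
    {ψ : ⋀[K]^n V →ₗ[K] K}
    (hψ : ∀ v : Fin n → V, (∀ i j, f (v i) (v j) = 0) → ψ (exteriorPower.ιMulti K n v) = 0) :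
    ψ = 0 := by
  obtain ⟨⟨A, hAS, hA⟩, -⟩ := hn
  obtain ⟨e, he, heA⟩ := exists_linearIndependent_span_eq hA
  have hmem : ∀ i, e i ∈ A := fun i => heA ▸ Submodule.subset_span ⟨i, rfl⟩
  obtain ⟨g, hg⟩ := hf.exists_hyperbolicSystem he fun i j => hAS _ (hmem i) _ (hmem j)
  let b := basisOfLinearIndependentOfCardEqFinrank' _ (hg.linearIndependent hf)
    (by simp [hN, two_mul])
  refine exteriorPower.linearMap_ext (Basis.ext_alternating b fun q hq => ?_)
  have h1 := apply_hyperbolicSystem_eq_zero hf (φ := ψ.compAlternatingMap (exteriorPower.ιMulti K n))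
    hψ hg q hq
  simpa [b, Function.comp_def] using h1

/-- Complete `a` to a hyperbolic basis `(a, g)`. The coordinates along `g` are the forms `f (a i)`,
so the matrix of `(a, y)` is block triangular and `vol (a, y) = vol b * det (f (a i) (y j))`. Thus
`μ = (vol b)⁻¹`. -/
theorem exists_isBaerVector (hf : IsHermitianForm σ f) (hN : finrank K V = 2 * n)
    {vol : V [⋀^Fin n ⊕ Fin n]→ₗ[K] K} (hvol : vol ≠ 0) {a : Fin n → V}
    (ha : LinearIndependent K a) (hiso : ∀ i j, f (a i) (a j) = 0) :
    ∃ μ, μ ≠ 0 ∧ IsBaerVector f vol μ (exteriorPower.ιMulti K n a) := by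
  obtain ⟨g, hg⟩ := hf.exists_hyperbolicSystem ha hiso
  let b := basisOfLinearIndependentOfCardEqFinrank' _ (hg.linearIndependent hf)
    (by simp [hN, two_mul])
  have hbl : ∀ i, b (Sum.inl i) = a i := fun i => by simp [b]
  have hbr : ∀ i, b (Sum.inr i) = g i := fun i => by simp [b]
  have hvolb : vol = vol b • b.det := vol.eq_smul_basis_det b
  have h0 : vol b ≠ 0 := fun h => hvol (by rw [hvolb, h, zero_smul])
  have hcoord : ∀ i, b.coord (Sum.inr i) = f (a i) := fun i => b.ext fun j => by
    rcases j with j | j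
    · rw [hbl, hiso, ← hbl, Basis.coord_apply, b.repr_self, Finsupp.single_apply]
      simp
    · rw [hbr, hg.dual, ← hbr, Basis.coord_apply, b.repr_self, Finsupp.single_apply]
      simp [eq_comm]
  refine ⟨(vol b)⁻¹, inv_ne_zero h0, fun y => ?_⟩
  have hdet : vol (Sum.elim a y) = vol b * b.det (Sum.elim a y) :=
    DFunLike.congr_fun hvolb (Sum.elim a y)
  rw [hf.map_formPairing_ιMulti, volPairing_ιMulti, hdet, inv_mul_cancel_left₀ h0, b.det_apply]
  have hblock : b.toMatrix (Sum.elim a y) =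
      Matrix.fromBlocks 1 (Matrix.of fun i j => b.repr (y j) (Sum.inl i)) 0
        (Matrix.of fun i j => f (a i) (y j)) := by
    ext i j
    rcases i with i | i <;> rcases j with j | j
    · rw [Basis.toMatrix_apply, Sum.elim_inl, ← hbl, b.repr_self]
      simp [Finsupp.single_apply, Matrix.one_apply, eq_comm]
    · simp [Basis.toMatrix_apply]
    · rw [Basis.toMatrix_apply, Sum.elim_inl, ← hbl, b.repr_self]
      simp
    · simp [Basis.toMatrix_apply, ← hcoord]
  rw [hblock, Matrix.det_fromBlocks_zero₂₁, Matrix.det_one, one_mul]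

omit [FiniteDimensional K V] in
theorem det_cons_cons (f : V →ₛₗ[σ] V →ₗ[K] K) {m : ℕ} {x y : Fin m → V} {a b : V}
    (h : ∀ i, f (x i) b = 0) :
    (Matrix.of fun i j : Fin (m + 1) => f ((Fin.cons a x : Fin (m + 1) → V) i)
      ((Fin.cons b y : Fin (m + 1) → V) j)).det =
      f a b * (Matrix.of fun i j => f (x i) (y j)).det := by
  rw [Matrix.det_succ_column_zero, Fin.sum_univ_succ, Finset.sum_eq_zero fun i _ => by simp [h]]
  simp only [Fin.val_zero, pow_zero, one_mul, add_zero, Matrix.of_apply, Fin.cons_zero]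
  congr 2

omit [FiniteDimensional K V] in
theorem vol_swap {m : ℕ} (vol : V [⋀^Fin (m + 1) ⊕ Fin (m + 1)]→ₗ[K] K) (x y : Fin m → V)
    (a b : V) : vol (Sum.elim (Fin.cons b x : Fin (m + 1) → V) (Fin.cons a y : Fin (m + 1) → V)) =
      -vol (Sum.elim (Fin.cons a x : Fin (m + 1) → V) (Fin.cons b y : Fin (m + 1) → V)) := by
  rw [← vol.map_swap _ (i := Sum.inl 0) (j := Sum.inr 0) (by simp)]
  congr 1
  ext (i | i) <;> refine Fin.cases ?_ (fun i => ?_) i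
  · simp
  · rw [Function.comp_apply, Equiv.swap_apply_of_ne_of_ne (by simp) (by simp)]
    simp
  · simp
  · rw [Function.comp_apply, Equiv.swap_apply_of_ne_of_ne (by simp) (by simp)]
    simp

/-- Being a Baer vector is transferred between adjacent maximal totally isotropic subspaces. -/
theorem isBaerVector_cons {m : ℕ} (hf : IsHermitianForm σ f) (hN : finrank K V = 2 * (m + 1))
    {vol : V [⋀^Fin (m + 1) ⊕ Fin (m + 1)]→ₗ[K] K} (hvol : vol ≠ 0) {μ : K} {x : Fin m → V}
    {a b : V} (hx : LinearIndependent K x) (hxx : ∀ i j, f (x i) (x j) = 0)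
    (hxa : ∀ i, f (x i) a = 0) (hxb : ∀ i, f (x i) b = 0) (hbb : f b b = 0)
    (hb : b ∉ Submodule.span K (Set.range x)) (hab : f a b ≠ 0) (hskew : σ (f a b) = -f a b)
    (ha : IsBaerVector f vol μ
      (exteriorPower.ιMulti K (m + 1) (Fin.cons a x : Fin (m + 1) → V))) :
    IsBaerVector f vol μ (exteriorPower.ιMulti K (m + 1) (Fin.cons b x : Fin (m + 1) → V)) := by
  obtain ⟨y, hy⟩ := hf.exists_dual_family hx
  have hdet : (Matrix.of fun i j => f (x i) (y j)).det = 1 := by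
    rw [← Matrix.det_one (n := Fin m)]
    congr 1
    ext i j
    simp [hy, Matrix.one_apply]
  obtain ⟨ν, -, hν⟩ := hf.exists_isBaerVector hN hvol (linearIndependent_finCons.2 ⟨hx, hb⟩)
    (by
      intro i j
      refine Fin.cases ?_ (fun i => ?_) i <;> refine Fin.cases ?_ (fun j => ?_) j
      · simpa
      · simpa using hf.apply_eq_zero_comm (hxb j)
      · simpa using hxb i
      · simpa using hxx i j)
  -- The Baer conditions for `a` and `b` are evaluated at families with first member `b` and `a`.
  -- Exchanging the two changes the sign of `vol`, and skewness changes the sign of `f a b`, so the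
  -- factors `μ` and `ν` agree.
  have h1 := ha (Fin.cons b y)
  rw [hf.map_formPairing_ιMulti, det_cons_cons f hxb, hdet, mul_one, volPairing_ιMulti] at h1
  have h2 := hν (Fin.cons a y)
  rw [hf.map_formPairing_ιMulti, det_cons_cons f hxa, hdet, mul_one, volPairing_ιMulti,
    vol_swap, ← hf.2.2.1, hskew, h1] at h2
  have h3 : vol (Sum.elim (Fin.cons a x : Fin (m + 1) → V) (Fin.cons b y : Fin (m + 1) → V)) ≠ 0 :=
    fun h => hab (by rw [h1, h, mul_zero])
  have h4 : μ = ν := by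
    rw [mul_neg, neg_inj] at h2
    exact mul_right_cancel₀ h3 h2
  exact h4 ▸ hν

/-- Otherwise `b` would be orthogonal to `X ⊔ K ∙ a = A`, which is its own orthogonal. -/
theorem apply_ne_zero_of_sup (hf : IsHermitianForm σ f) (hN : finrank K V = 2 * n)
    {X A B : Submodule K V} {a b : V} (hAS : A ∈ isotropicSubspaces f)
    (hA : finrank K A = n) (hBS : B ∈ isotropicSubspaces f) (hXA : X ≤ A) (hXB : X ≤ B)
    (hX : finrank K X + 1 = n) (ha : a ∈ A) (haX : a ∉ X) (hb : b ∈ B) (hbA : b ∉ A) :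
    f a b ≠ 0 := by
  intro h
  refine hbA (hf.mem_of_orthogonal hN A hAS hA b fun v hv => ?_)
  rw [← sup_span_singleton_eq hXA (by omega) ha haX] at hv
  obtain ⟨x, hx, y, hy, rfl⟩ := Submodule.mem_sup.1 hv
  obtain ⟨t, rfl⟩ := Submodule.mem_span_singleton.1 hy
  simp [h, hBS x (hXB hx) b hb]

/-- The vector `b` completing `A ⊓ B` to `B` may be rescaled so that `f a b` is skew, and then the
factor `μ` is inherited. -/
theorem exists_isBaerVector_of_adj (hf : IsHermitianForm σ f) (hN : finrank K V = 2 * n)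
    {vol : V [⋀^Fin n ⊕ Fin n]→ₗ[K] K} (hvol : vol ≠ 0) {μ : K}
    {A B : PolarPoint (isotropicSubspaces f) n}
    (hadj : (polarGrassmannian (isotropicSubspaces f) n n).collinearityGraph.Adj A B)
    (hA : ∃ w hw, polarPluckerMap _ n A = .mk K w hw ∧ IsBaerVector f vol μ w) :
    ∃ w hw, polarPluckerMap _ n B = .mk K w hw ∧ IsBaerVector f vol μ w := by
  obtain ⟨w, hw, hAw, hwB⟩ := hA
  obtain ⟨A, hAS, hAn⟩ := A
  obtain ⟨B, hBS, hBn⟩ := B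
  have hd := (IsPolarSystem.finrank_inf_of_adj hadj).1
  simp only at hd
  obtain ⟨m, rfl⟩ : ∃ m, n = m + 1 := ⟨_, hd.symm⟩
  have hdm : finrank K (A ⊓ B : Submodule K V) = m := by omega
  obtain ⟨x, hx, hxX⟩ := exists_linearIndependent_span_eq hdm
  obtain ⟨a, haA, haX, rfl⟩ := exists_eq_mk_cons hx hxX inf_le_left hAn hAw
  obtain ⟨b, hbB, hbA⟩ : ∃ b ∈ B, b ∉ A := by
    by_contra! h
    rw [inf_eq_right.2 h] at hd
    omega
  have hab := hf.apply_ne_zero_of_sup hN hAS hAn hBS inf_le_left inf_le_right hd haA haX hbB hbA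
  obtain ⟨s, hs, hσs⟩ := hf.exists_skew
  have hc : s / f a b ≠ 0 := div_ne_zero hs hab
  have hab' : f a ((s / f a b) • b) = s := by
    rw [map_smul, smul_eq_mul, div_mul_cancel₀ _ hab]
  have hbB' := B.smul_mem (s / f a b) hbB
  have hbX : (s / f a b) • b ∉ A ⊓ B := fun h => hbA ((Submodule.smul_mem_iff _ hc).1 h.1)
  have hxm : ∀ i, x i ∈ A ⊓ B := fun i => hxX ▸ Submodule.subset_span ⟨i, rfl⟩
  refine ⟨_, _, pluckerPoint_cons hx hxX inf_le_right hBn hbB' hbX, ?_⟩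
  exact hf.isBaerVector_cons hN hvol hx (fun i j => hAS _ (hxm i).1 _ (hxm j).1)
    (fun i => hAS _ (hxm i).1 _ haA) (fun i => hBS _ (hxm i).2 _ hbB') (hBS _ hbB' _ hbB')
    (hxX ▸ hbX) (by rwa [hab']) (by rwa [hab']) hwB

/-- All the maximal totally isotropic subspaces are represented by Baer vectors as soon as one
of them is. -/
theorem exists_isBaerVector_of_reachable (hf : IsHermitianForm σ f) (hN : finrank K V = 2 * n)
    {vol : V [⋀^Fin n ⊕ Fin n]→ₗ[K] K} (hvol : vol ≠ 0) {μ : K}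
    {A B : PolarPoint (isotropicSubspaces f) n}
    (hAB : (polarGrassmannian (isotropicSubspaces f) n n).collinearityGraph.Reachable A B)
    (hA : ∃ w hw, polarPluckerMap _ n A = .mk K w hw ∧ IsBaerVector f vol μ w) :
    ∃ w hw, polarPluckerMap _ n B = .mk K w hw ∧ IsBaerVector f vol μ w := by
  obtain ⟨p⟩ := hAB
  induction p with
  | nil => exact hA
  | cons hadj _ ih => exact ih (hf.exists_isBaerVector_of_adj hN hvol hadj hA)

theorem exists_isBaerCodomain (hf : IsHermitianForm σ f)
    (hn : HasPolarRank (isotropicSubspaces f) n) (hN : finrank K V = 2 * n) :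
    ∃ W : Submodule (fixedSubfield σ) (⋀[K]^n V),
      IsBaerCodomain σ (isotropicSubspaces f) n W := by
  let b := finBasisOfFinrankEq K V hN
  let vol : V [⋀^Fin n ⊕ Fin n]→ₗ[K] K :=
    (b.reindex ((finCongr (two_mul n)).trans finSumFinEquiv.symm)).det
  have hvol : vol ≠ 0 := Basis.det_ne_zero _
  obtain ⟨A₀⟩ := hf.isPolarSystem.nonempty_polarPoint hn le_rfl
  obtain ⟨a, ha, haA⟩ := exists_linearIndependent_span_eq A₀.2.2
  have ham : ∀ i, a i ∈ A₀.1 := fun i => haA ▸ Submodule.subset_span ⟨i, rfl⟩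
  obtain ⟨μ, hμ, hμa⟩ := hf.exists_isBaerVector hN hvol ha
    fun i j => A₀.2.1 _ (ham i) _ (ham j)
  have hrep : ∀ A : PolarPoint (isotropicSubspaces f) n,
      ∃ w hw, polarPluckerMap _ n A = .mk K w hw ∧ IsBaerVector f vol μ w := fun A =>
    hf.exists_isBaerVector_of_reachable hN hvol
      ((hf.isPolarSystem.isAdmissible_dual hn).connected A₀ A)
      ⟨_, _, pluckerPoint_eq _ A₀.2.2 a ha ham, hμa⟩
  let G : Set (⋀[K]^n V) := {w | ∃ A : PolarPoint (isotropicSubspaces f) n, ∃ hw,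
    polarPluckerMap _ n A = .mk K w hw ∧ IsBaerVector f vol μ w}
  -- A functional vanishing on Baer representatives vanishes on all isotropic decomposable vectors,
  -- hence everywhere. A basis can therefore be chosen inside `G`.
  have hG : ⊤ ≤ Submodule.span K G := by
    by_contra hlt
    obtain ⟨ψ, hψ0, hψ⟩ := Submodule.exists_le_ker_of_lt_top _ (lt_of_le_not_ge le_top hlt)
    refine hψ0 (hf.eq_zero_of_forall_isotropic hn hN fun v hv => ?_)
    by_cases hvi : LinearIndependent K v
    · have hvS : Submodule.span K (Set.range v) ∈ isotropicSubspaces f := by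
        intro x hx y hy
        induction hx, hy using Submodule.span_induction₂ with
        | mem_mem x y hx hy =>
          obtain ⟨i, rfl⟩ := hx
          obtain ⟨j, rfl⟩ := hy
          exact hv i j
        | zero_left => simp
        | zero_right => simp
        | add_left _ _ _ _ _ _ h1 h2 => simp [h1, h2]
        | add_right _ _ _ _ _ _ h1 h2 => simp [h1, h2]
        | smul_left _ _ _ _ _ h => simp [h]
        | smul_right _ _ _ _ _ h => simp [h]
      have hvd : finrank K (Submodule.span K (Set.range v)) = n := by
        rw [finrank_span_eq_card hvi, Fintype.card_fin]
      obtain ⟨w, hw, hA, hwB⟩ := hrep ⟨_, hvS, hvd⟩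
      have hw0 : ψ w = 0 := hψ (Submodule.subset_span ⟨_, hw, hA, hwB⟩)
      rw [polarPluckerMap, pluckerPoint_eq _ hvd v hvi fun i => Submodule.subset_span ⟨i, rfl⟩,
        Projectivization.mk_eq_mk_iff'] at hA
      obtain ⟨t, ht⟩ := hA
      rw [← ht, map_smul, hw0, smul_zero]
    · rw [AlternatingMap.map_linearDependent _ _ hvi, map_zero]
  let U₀ := Basis.ofSpan hG
  let U := U₀.reindex (U₀.indexEquiv (finBasis K (⋀[K]^n V)))
  have hU : ∀ i, U i ∈ G := fun i => Basis.ofSpan_subset hG ⟨_, (U₀.reindex_apply _ i).symm⟩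
  refine ⟨Submodule.span (fixedSubfield σ) (Set.range U), ⟨U, fun i => ?_, rfl⟩, fun A => ?_⟩
  · obtain ⟨A, hw, hA, -⟩ := hU i
    exact ⟨A, by rw [hA, Projectivization.submodule_mk]⟩
  · obtain ⟨w, hw, hA, hwB⟩ := hrep A
    suffices hmem : w ∈ Submodule.span (fixedSubfield σ) (Set.range U) by
      exact ⟨⟨w, hmem⟩, fun h => hw (congrArg Subtype.val h),
        by rw [hA, Projectivization.submodule_mk]⟩
    rw [U.mem_span_iff_repr_mem (fixedSubfield σ)]
    intro i
    suffices hfix : σ (U.repr w i) = U.repr w i from ⟨⟨_, hfix⟩, rfl⟩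
    -- Subtracting the Baer condition of `w` from the combination of those of the `U j` shows that
    -- the extended form annihilates this vector.
    have hzero : ∑ j, (σ (U.repr w j) - U.repr w j) • U j = 0 := by
      refine hf.eq_zero_of_formPairing fun y => σ.injective ?_
      have h1 := hwB y
      rw [← U.sum_repr w] at h1
      simp only [map_sum, map_smul, smul_eq_mul, map_mul, Finset.mul_sum, mul_left_comm μ] at h1
      simp only [← (hU _).choose_spec.choose_spec.2 y] at h1
      simp only [map_sum, map_smul, smul_eq_mul, map_mul, map_sub, hf.1, sub_mul,
        Finset.sum_sub_distrib, h1, sub_self, map_zero]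
    have := Fintype.linearIndependent_iff.1 U.linearIndependent _ hzero i
    exact sub_eq_zero.1 this

end IsHermitianForm

end BaerSubgeometry

/-! ### Transparency in the Baer subgeometry -/

section BaerTransparency

variable {K V : Type*} [Field K] [AddCommGroup V] [Module K V] [FiniteDimensional K V]
  {σ : K →+* K} {n : ℕ}

namespace IsBaerCodomain

section

variable {S : Set (Submodule K V)} {W : Submodule (fixedSubfield σ) (⋀[K]^n V)}

/-- If a linear combination of two independent vectors of `W` belongs to `W`, then its
coefficients are fixed by `σ`. -/
theorem map_coeff_eq (hW : IsBaerCodomain σ S n W) {v w : ⋀[K]^n V}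
    (hv : v ∈ W) (hw : w ∈ W) (hvw : LinearIndependent K ![v, w]) {α β : K}
    (h : α • v + β • w ∈ W) : σ α = α ∧ σ β = β := by
  obtain ⟨U, -, rfl⟩ := hW.exists_basis
  have hfix : ∀ u ∈ Submodule.span (fixedSubfield σ) (Set.range U), ∀ i,
      σ (U.repr u i) = U.repr u i := by
    intro u hu i
    obtain ⟨c, hc⟩ := (U.mem_span_iff_repr_mem (fixedSubfield σ) u).1 hu i
    rw [← hc]
    exact c.2
  have hzero : (σ α - α) • v + (σ β - β) • w = 0 := by
    refine U.ext_elem fun i => ?_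
    have h1 := hfix _ h i
    simp only [map_add, map_smul, Finsupp.add_apply, Finsupp.smul_apply, smul_eq_mul, map_mul,
      hfix v hv i, hfix w hw i, map_zero, Finsupp.zero_apply] at h1 ⊢
    linear_combination h1
  obtain ⟨h1, h2⟩ := LinearIndependent.pair_iff.1 hvw _ _ hzero
  exact ⟨sub_eq_zero.1 h1, sub_eq_zero.1 h2⟩

theorem map_coeff_eq_of_smul (hW : IsBaerCodomain σ S n W) {v : ⋀[K]^n V}
    (hv : v ∈ W) (hv0 : v ≠ 0) {α : K} (h : α • v ∈ W) : σ α = α := by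
  obtain ⟨U, -, rfl⟩ := hW.exists_basis
  obtain ⟨i, hi⟩ : ∃ i, U.repr v i ≠ 0 := by
    by_contra! h0
    exact hv0 (U.ext_elem fun i => by simpa using h0 i)
  obtain ⟨c, hc⟩ := (U.mem_span_iff_repr_mem (fixedSubfield σ) v).1 hv i
  obtain ⟨d, hd⟩ := (U.mem_span_iff_repr_mem (fixedSubfield σ) _).1 h i
  have h1 : σ (U.repr v i) = U.repr v i := hc ▸ c.2
  have h2 : σ (U.repr (α • v) i) = U.repr (α • v) i := hd ▸ d.2
  rw [map_smul, Finsupp.smul_apply, smul_eq_mul, map_mul, h1] at h2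
  exact mul_right_cancel₀ hi h2

theorem exists_mk_eq (hW : IsBaerCodomain σ S n W) (A : PolarPoint S n) :
    ∃ w ∈ W, ∃ hw : w ≠ 0, polarPluckerMap S n A = .mk K w hw := by
  obtain ⟨w, hw, h⟩ := hW.exists_rep A
  have hw' : (w : ⋀[K]^n V) ≠ 0 := fun h => hw (Subtype.ext h)
  exact ⟨w, w.2, hw', Projectivization.submodule_injective
    (by rw [h, Projectivization.submodule_mk])⟩

/-- Two non-zero vectors of `W` on one `K`-line differ by a scalar fixed by `σ`, so the chosen
representative is immaterial. -/
theorem baerPlucker_eq (hW : IsBaerCodomain σ S n W) {A : PolarPoint S n} {w : ⋀[K]^n V}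
    (hwW : w ∈ W) {hw : w ≠ 0} (h : polarPluckerMap S n A = .mk K w hw) :
    baerPlucker hW A = .mk (fixedSubfield σ) ⟨w, hwW⟩ fun h0 => hw (congrArg Subtype.val h0) := by
  obtain ⟨h0, h1⟩ := (hW.exists_rep A).choose_spec
  rw [baerPlucker, Projectivization.mk_eq_mk_iff']
  have h2 : (polarPluckerMap S n A).submodule = K ∙ w := by rw [h, Projectivization.submodule_mk]
  have hmem := h2.le (h1.ge (Submodule.mem_span_singleton_self _))
  obtain ⟨c, hc⟩ := Submodule.mem_span_singleton.1 hmem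
  have hσ := hW.map_coeff_eq_of_smul hwW hw (α := c) (hc ▸ (hW.exists_rep A).choose.2)
  exact ⟨⟨c, hσ⟩, Subtype.ext hc⟩

theorem baerPlucker_injective (hW : IsBaerCodomain σ S n W) :
    Function.Injective (baerPlucker hW) := by
  intro A B hAB
  obtain ⟨v, hv, hv0, hA⟩ := hW.exists_mk_eq A
  obtain ⟨w, hw, hw0, hB⟩ := hW.exists_mk_eq B
  rw [hW.baerPlucker_eq hv hA, hW.baerPlucker_eq hw hB, Projectivization.mk_eq_mk_iff'] at hAB
  obtain ⟨c, hc⟩ := hAB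
  apply IsPolarSystem.polarPluckerMap_injective
  rw [hA, hB, Projectivization.mk_eq_mk_iff']
  exact ⟨c, congrArg Subtype.val hc⟩

theorem iSup_baerPlucker (hW : IsBaerCodomain σ S n W) :
    ⨆ A, (baerPlucker hW A).submodule = ⊤ := by
  obtain ⟨U, hU, hspan⟩ := hW.exists_basis
  apply Submodule.map_injective_of_injective W.injective_subtype
  rw [Submodule.map_top, Submodule.range_subtype]
  refine le_antisymm (Submodule.map_subtype_le _ _) ?_
  conv_lhs => rw [hspan]
  rw [Submodule.span_le]
  rintro _ ⟨i, rfl⟩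
  obtain ⟨A, hA⟩ := hU i
  have hUW : U i ∈ W := hspan ▸ Submodule.subset_span ⟨i, rfl⟩
  have h1 : polarPluckerMap S n A = .mk K (U i) (U.ne_zero i) :=
    Projectivization.submodule_injective (by rw [hA, Projectivization.submodule_mk])
  have h2 : (baerPlucker hW A).submodule ≤ ⨆ A, (baerPlucker hW A).submodule :=
    le_iSup (fun A => (baerPlucker hW A).submodule) A
  rw [hW.baerPlucker_eq hUW h1, Projectivization.submodule_mk] at h2
  exact ⟨_, h2 (Submodule.mem_span_singleton_self _), rfl⟩

end

section

variable {f : V →ₛₗ[σ] V →ₗ[K] K}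
  {W : Submodule (fixedSubfield σ) (⋀[K]^n V)}

/-- The Plücker map sends the lines of the dual polar space to full lines of the Baer
subgeometry. -/
theorem exists_image_eq_joinPoints (hf : IsHermitianForm σ f)
    (hn : HasPolarRank (isotropicSubspaces f) n) (hN : finrank K V = 2 * n)
    (hW : IsBaerCodomain σ (isotropicSubspaces f) n W)
    {l : Set (PolarPoint (isotropicSubspaces f) n)}
    (hl : l ∈ (polarGrassmannian (isotropicSubspaces f) n n).lines) :
    ∃ A B, A ≠ B ∧ baerPlucker hW '' l = joinPoints (baerPlucker hW A) (baerPlucker hW B) := by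
  have hS := hf.isPolarSystem
  rcases hl with ⟨h, -⟩ | ⟨-, X, hXS, hX, rfl⟩
  · omega
  obtain ⟨m, rfl⟩ : ∃ m, n = m + 1 := ⟨_, hX.symm⟩
  obtain ⟨x, hx, hxX⟩ := exists_linearIndependent_span_eq (A := X) (Nat.add_right_cancel hX)
  obtain ⟨A, hAS, hXA, hA⟩ := hS.exists_ge_finrank_eq hn hXS
  obtain ⟨wa, haW, ha0, hAa⟩ := hW.exists_mk_eq ⟨A, hAS, hA⟩
  obtain ⟨a, haA, haX, rfl⟩ := exists_eq_mk_cons hx hxX hXA hA hAa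
  have hXa : ∀ v ∈ X, f v a = 0 := fun v hv => hAS v (hXA hv) a haA
  have hmemS : ∀ v, (∀ u ∈ X, f u v = 0) → f v v = 0 → X ⊔ K ∙ v ∈ isotropicSubspaces f := by
    intro v hv hvv
    refine hS.sup X hXS _ (fun u hu u' hu' => ?_) fun u hu u' hu' => ?_
    · obtain ⟨s, rfl⟩ := Submodule.mem_span_singleton.1 hu
      obtain ⟨t, rfl⟩ := Submodule.mem_span_singleton.1 hu'
      simp [hvv]
    · obtain ⟨t, rfl⟩ := Submodule.mem_span_singleton.1 hu'
      simp [hv u hu]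
  obtain ⟨y, hy, hay⟩ := hf.exists_orthogonal haX
  obtain ⟨t, ht⟩ := hf.exists_add_apply_eq (c := -f y y) (by rw [map_neg, hf.2.2.1])
  have hya : f y a ≠ 0 := fun h => hay (hf.apply_eq_zero_comm h)
  -- Since `f a a = 0`, this correction changes `f y y` by `t + σ t`, which makes `b₀` isotropic; it
  -- remains orthogonal to `X` and not to `a`.
  set b₀ := y + (t / f y a) • a with hb₀
  have hb₀X : ∀ u ∈ X, f u b₀ = 0 := fun u hu => by simp [hb₀, hy u hu, hXa u hu]
  have haa : f a a = 0 := hAS a haA a haA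
  have hb₀b₀ : f b₀ b₀ = 0 := by
    have h1 : σ (f y a) = f a y := hf.2.2.1 y a
    simp only [hb₀, map_add, LinearMap.add_apply, map_smul, LinearMap.map_smulₛₗ,
      LinearMap.smul_apply, smul_eq_mul, haa, map_div₀, h1, div_mul_cancel₀ _ hay]
    linear_combination ht + div_mul_cancel₀ t hya
  have hab₀ : f a b₀ ≠ 0 := by simpa [hb₀, haa] using hay
  have hb₀X' : b₀ ∉ X := fun h => hab₀ (hAS a haA b₀ (hXA h))
  have hBS := hmemS b₀ hb₀X hb₀b₀
  have hB : finrank K (X ⊔ K ∙ b₀ : Submodule K V) = m + 1 := by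
    rw [Submodule.finrank_sup_span_singleton hb₀X', hX]
  obtain ⟨B, hXB, hB₀B⟩ : ∃ B : Submodule K V, X ≤ B ∧ B = X ⊔ K ∙ b₀ := ⟨_, le_sup_left, rfl⟩
  have hb₀B : b₀ ∈ B := hB₀B ▸ Submodule.mem_sup_right (Submodule.mem_span_singleton_self _)
  rw [← hB₀B] at hBS hB
  obtain ⟨wb, hbW, hb0, hBb⟩ := hW.exists_mk_eq ⟨B, hBS, hB⟩
  -- `b` replaces `b₀` so that its wedge with the basis of `X` lies in `W`.
  obtain ⟨b, hbB, hbX, rfl⟩ := exists_eq_mk_cons hx hxX hXB hB hBb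
  have hne : A ≠ B := fun h => hab₀ (hAS a haA b₀ (h ▸ hb₀B))
  have hinf : A ⊓ B = X := inf_eq_of_finrank hA hB hXA hXB hX hne
  have hbA : b ∉ A := fun h => hbX (hinf ▸ ⟨h, hbB⟩)
  have hXb : ∀ v ∈ X, f v b = 0 := fun v hv => hBS v (hXB hv) b hbB
  have hbb : f b b = 0 := hBS b hbB b hbB
  have hab : f a b ≠ 0 :=
    hf.apply_ne_zero_of_sup hN hAS hA hBS hXA hXB hX haA haX hbB hbA
  set wa := exteriorPower.ιMulti K (m + 1) (Fin.cons a x : Fin (m + 1) → V)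
  set wb := exteriorPower.ιMulti K (m + 1) (Fin.cons b x : Fin (m + 1) → V)
  have hind : LinearIndependent K ![wa, wb] := by
    rw [LinearIndependent.pair_iff' ha0]
    intro c hc
    apply hne
    refine (congrArg Subtype.val (IsPolarSystem.polarPluckerMap_injective
      (a₁ := ⟨B, hBS, hB⟩) (a₂ := ⟨A, hAS, hA⟩) ?_)).symm
    rw [hAa, hBb, Projectivization.mk_eq_mk_iff']
    exact ⟨c, hc⟩
  have hcomb : ∀ α β : K, α • a + β • b ∈ X → α = 0 ∧ β = 0 := by
    intro α β h
    have h1 := hXA h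
    have hβ : β = 0 := by
      by_contra hβ
      have h2 := A.sub_mem h1 (A.smul_mem α haA)
      rw [add_sub_cancel_left, Submodule.smul_mem_iff _ hβ] at h2
      exact hbA h2
    refine ⟨?_, hβ⟩
    by_contra hα
    rw [hβ, zero_smul, add_zero, Submodule.smul_mem_iff _ hα] at h
    exact haX h
  -- The equation says that `α • a + β • b` is isotropic; adjoined to `X`, it gives the point of the
  -- line with these coordinates.
  have hpoint : ∀ α β : K, ¬ (α = 0 ∧ β = 0) → α * σ β * f b a + σ α * β * f a b = 0 →
      ∃ (C : PolarPoint (isotropicSubspaces f) (m + 1)) (h0 : α • wa + β • wb ≠ 0), X ≤ C.1 ∧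
        polarPluckerMap _ (m + 1) C = .mk K (α • wa + β • wb) h0 := by
    intro α β h0 hz
    have hc : α • a + β • b ∉ X := fun h => h0 (hcomb α β h)
    have hCS := hmemS (α • a + β • b) (fun u hu => by simp [hXa u hu, hXb u hu]) (by
      simp only [map_add, LinearMap.add_apply, map_smul, LinearMap.map_smulₛₗ,
        LinearMap.smul_apply, smul_eq_mul, haa, hbb]
      linear_combination hz)
    have hC : finrank K (X ⊔ K ∙ (α • a + β • b) : Submodule K V) = m + 1 := by
      rw [Submodule.finrank_sup_span_singleton hc, hX]
    have hne0 : α • wa + β • wb ≠ 0 := fun h => h0 (LinearIndependent.pair_iff.1 hind _ _ h)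
    refine ⟨⟨_, hCS, hC⟩, hne0, le_sup_left, ?_⟩
    rw [polarPluckerMap, pluckerPoint_cons hx hxX le_sup_left hC
      (Submodule.mem_sup_right (Submodule.mem_span_singleton_self _)) hc]
    congr 1
    exact ιMulti_cons_add x a b α β
  have hba : f b a = σ (f a b) := (hf.2.2.1 a b).symm
  -- a third point of the line shows that `f a b` is skew
  have hskew : σ (f a b) = -f a b := by
    obtain ⟨s, hs, hσs⟩ := hf.exists_skew
    -- For this coefficient isotropy reads `σ s + s = 0`. The representative of `C` in `W` has
    -- coefficients `r` and `r * (s / f a b)`, both fixed by `σ`; so `s / f a b` is fixed, and `f a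
    -- b` is skew like `s`.
    obtain ⟨C, h0, -, hC⟩ := hpoint 1 (s / f a b) (by simp) (by
      have h2 : σ (f a b) ≠ 0 := by rwa [← hba, ne_eq, ← map_eq_zero σ, hf.2.2.1]
      rw [map_div₀, hba, map_one, one_mul, one_mul, div_mul_cancel₀ _ hab,
        div_mul_cancel₀ _ h2, hσs, neg_add_cancel])
    obtain ⟨w, hwW, hw0, hw⟩ := hW.exists_mk_eq C
    rw [hC, eq_comm, Projectivization.mk_eq_mk_iff'] at hw
    obtain ⟨r, hr⟩ := hw
    have hr0 : r ≠ 0 := by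
      rintro rfl
      exact hw0 (by rw [← hr, zero_smul])
    rw [smul_add, one_smul, smul_smul] at hr
    obtain ⟨h1, h2⟩ := hW.map_coeff_eq haW hbW hind (hr ▸ hwW)
    rw [map_mul, h1, map_div₀, hσs] at h2
    have h3 := mul_left_cancel₀ hr0 h2
    have h4 : σ (f a b) ≠ 0 := by rwa [← hba, ne_eq, ← map_eq_zero σ, hf.2.2.1]
    rw [div_eq_div_iff h4 hab] at h3
    have h5 : s * (σ (f a b) + f a b) = 0 := by linear_combination -h3
    exact eq_neg_of_add_eq_zero_left ((mul_eq_zero.1 h5).resolve_left hs)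
  refine ⟨⟨A, hAS, hA⟩, ⟨B, hBS, hB⟩, fun h => hne (congrArg Subtype.val h), ?_⟩
  rw [hW.baerPlucker_eq haW hAa, hW.baerPlucker_eq hbW hBb]
  ext r
  constructor
  · rintro ⟨Z, hZ, rfl⟩
    obtain ⟨w, hwW, hw0, hw⟩ := hW.exists_mk_eq Z
    have hZle : Z.1 ≤ A ⊔ B := hS.le_sup_of_inf_le (hf.mem_of_orthogonal hN) hAS hA hB hBS
      (hinf ▸ hX) Z.2.1 (hinf ▸ hZ)
    have hjoin : polarPluckerMap _ (m + 1) Z ∈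
        joinPoints (pluckerPoint A hA) (pluckerPoint B hB) := by
      rw [joinPoints_pluckerPoint (hinf ▸ hX)]
      exact ⟨Z.1, Z.2.2, hinf ▸ hZ, hZle, rfl⟩
    have hAa' : pluckerPoint A hA = .mk K wa ha0 := hAa
    have hBb' : pluckerPoint B hB = .mk K wb hb0 := hBb
    rw [hw, hAa', hBb', mk_mem_joinPoints_mk] at hjoin
    obtain ⟨α, β, hαβ⟩ := hjoin
    obtain ⟨h1, h2⟩ := hW.map_coeff_eq haW hbW hind (hαβ ▸ hwW)
    rw [hW.baerPlucker_eq hwW hw, mk_mem_joinPoints_mk]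
    exact ⟨⟨α, h1⟩, ⟨β, h2⟩, Subtype.ext hαβ⟩
  · intro hr
    induction r using Projectivization.ind with
    | h v hv =>
      rw [mk_mem_joinPoints_mk] at hr
      obtain ⟨α, β, hαβ⟩ := hr
      have hαβ' : (α : K) • wa + (β : K) • wb = v := congrArg Subtype.val hαβ
      obtain ⟨C, h0, hXC, hC⟩ := hpoint α β (by
        rintro ⟨h1, h2⟩
        rw [h1, h2, zero_smul, zero_smul, add_zero] at hαβ'
        exact hv (Subtype.ext hαβ'.symm)) (by
          have h1 : σ α = α := α.2
          have h2 : σ β = β := β.2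
          rw [h1, h2, hba, hskew]
          ring)
      refine ⟨C, hXC, ?_⟩
      rw [hW.baerPlucker_eq (hαβ' ▸ v.2) hC]
      congr 1

/-- The single point represented by `v + w` suffices. Its coefficients already lie in the fixed
field, so `finrank_inf_of_add` applies over `K` although only a Baer line is contained in the image.
-/
theorem isTransparent (hf : IsHermitianForm σ f)
    (hn : HasPolarRank (isotropicSubspaces f) n) (hN : finrank K V = 2 * n)
    (hW : IsBaerCodomain σ (isotropicSubspaces f) n W) :
    IsTransparent (polarGrassmannian (isotropicSubspaces f) n n) (baerPlucker hW) := by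
  refine (IsProjectiveEmbedding.of_joinPoints (hf.isPolarSystem.isAdmissible_dual hn)
    hW.baerPlucker_injective hW.iSup_baerPlucker
    fun l hl => hW.exists_image_eq_joinPoints hf hn hN hl).isTransparent fun A B hne h => ?_
  obtain ⟨v, hv, hv0, hA⟩ := hW.exists_mk_eq A
  obtain ⟨w, hw, hw0, hB⟩ := hW.exists_mk_eq B
  have h0 : v + w ≠ 0 := by
    intro h0
    apply hne
    apply IsPolarSystem.polarPluckerMap_injective
    rw [hA, hB, Projectivization.mk_eq_mk_iff']
    exact ⟨-1, by rw [neg_one_smul, eq_neg_of_add_eq_zero_left h0]⟩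
  rw [hW.baerPlucker_eq hv hA, hW.baerPlucker_eq hw hB] at h
  have hmem := h ((mk_mem_joinPoints_mk (u := (⟨v, hv⟩ + ⟨w, hw⟩ : W))
    (fun h' => h0 (congrArg Subtype.val h')) _ _).2 ⟨1, 1, by simp⟩)
  obtain ⟨C, hC⟩ := hmem
  obtain ⟨u, hu, hu0, hCu⟩ := hW.exists_mk_eq C
  rw [hW.baerPlucker_eq hu hCu, Projectivization.mk_eq_mk_iff'] at hC
  obtain ⟨c, hc⟩ := hC
  have hCvw : polarPluckerMap _ n C = .mk K (v + w) h0 := by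
    rw [hCu, Projectivization.mk_eq_mk_iff']
    exact ⟨c, congrArg Subtype.val hc⟩
  exact (hf.isPolarSystem.adj_of_finrank_inf (finrank_inf_of_add (hA := A.2.2) (hB := B.2.2)
    (hC := C.2.2) hA hB hCvw fun h' => hne (Subtype.ext h'))).2

end

end IsBaerCodomain

end BaerTransparency

theorem theorem1 {K : Type*} [Field K] {V : Type*} [AddCommGroup V] [Module K V]
    [FiniteDimensional K V] :
    -- projective grassmannians
    (∀ k : ℕ, 1 ≤ k → k < finrank K V →
      IsTransparent (projGrassmannian K V k) (projPlucker K V k)) ∧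
    -- orthogonal polar grassmannians
    (∀ (q : QuadraticForm K V) (n k : ℕ), IsNonsingularQuadratic q →
      HasPolarRank (singularSubspaces q) n → 2 ≤ n → 1 ≤ k → k < n →
      IsTransparent (polarGrassmannian (singularSubspaces q) n k)
        (polarPlucker (singularSubspaces q) k)) ∧
    -- hermitian polar grassmannians
    (∀ (σ : K →+* K) (f : V →ₛₗ[σ] V →ₗ[K] K) (n k : ℕ), IsHermitianForm σ f →
      HasPolarRank (isotropicSubspaces f) n → 2 ≤ n → 1 ≤ k → k < n →
      IsTransparent (polarGrassmannian (isotropicSubspaces f) n k)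
        (polarPlucker (isotropicSubspaces f) k)) ∧
    -- symplectic polar grassmannians
    (∀ (f : V →ₗ[K] V →ₗ[K] K) (n : ℕ), IsSymplecticForm f →
      HasPolarRank (isotropicSubspaces f) n → 2 ≤ n →
      IsCompletelyOpaque (polarGrassmannian (isotropicSubspaces f) n 1)
        (polarPlucker (isotropicSubspaces f) 1) ∧
      (∀ k : ℕ, 1 < k → k < n →
        IsOpaque (polarGrassmannian (isotropicSubspaces f) n k)
          (polarPlucker (isotropicSubspaces f) k) 0 1) ∧
      IsTransparent (polarGrassmannian (isotropicSubspaces f) n n)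
        (polarPlucker (isotropicSubspaces f) n)) ∧
    -- hermitian dual polar spaces in dimension `2n`
    (∀ (σ : K →+* K) (f : V →ₛₗ[σ] V →ₗ[K] K) (n : ℕ), IsHermitianForm σ f →
      HasPolarRank (isotropicSubspaces f) n → 2 ≤ n → finrank K V = 2 * n →
      (∃ W : Submodule (fixedSubfield σ) (⋀[K]^n V),
        IsBaerCodomain σ (isotropicSubspaces f) n W) ∧
      ∀ (W : Submodule (fixedSubfield σ) (⋀[K]^n V))
        (hW : IsBaerCodomain σ (isotropicSubspaces f) n W),
        IsTransparent (polarGrassmannian (isotropicSubspaces f) n n) (baerPlucker hW)) := by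
  refine ⟨fun k _ hk => isTransparent_projPlucker hk.le,
    fun q n k _ hn _ _ hk => isTransparent_quadratic hn hk,
    fun σ f n k hf hn _ _ hk => isTransparent_hermitian hf hn hk,
    fun f n hf hn h2 => ⟨hf.isCompletelyOpaque hn h2, fun k h1 hk => hf.isOpaque hn h1 hk,
      hf.isTransparent_dual hn⟩,
    fun σ f n hf hn _ hN => ⟨hf.exists_isBaerCodomain hn hN,
      fun W hW => hW.isTransparent hf hn hN⟩⟩
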